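/- Let $\mathcal X$ be a set (of contexts) and let $\mathcal H$ be a nonempty, possibly infinite, class of functions $h:\mathcal X\to\mathbb R$ with $|h(x)|\le B$ for all $h\in\mathcal H$, $x\in\mathcal X$. Let $\beta\ge 0$, and suppose that $\mathcal H$ has a finite $\beta$-cover in the $L_\infty$ metric, i.e. a finite set $\mathcal H'\subseteq\mathcal H$ such that for every $h\in\mathcal H$ there is $h'\in\mathcal H'$ with $\sup_{x\in\mathcal X}|h(x)-h'(x)|\le\beta$. Let $\mathcal H_\beta=\{h^1,\dots,h^N\}$ be a $\beta$-cover of the smallest possible size $N=|\mathcal H_\beta|$, and let $T\ge 1$ be the horizon. Online protocol: the learner fixes an integer $m\ge 1$ and uses the forecasts $\mathcal P=\{0,\tfrac1m,\dots,1\}$. In each round $t=1,\dots,T$ an arbitrary adversary (adaptive to all earlier rounds, and possibly randomized) selects a context $x_t\in\mathcal X$ and a label $y_t\in[0,1]$; the learner sees $x_t$, selects a probability distribution $w_t$ on $\mathcal P$, outputs $p_t\in\mathcal P$ drawn from $w_t$, and then observes $y_t$. For the transcript $\pi_T=(x_t,y_t,p_t)_{t=1}^T$ put $$K(\pi_T,h)=\sum_{p\in\mathcal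 P}\frac1T\Big|\sum_{t\le T:\,p_t=p}h(x_t)(y_t-p_t)\Big|,\qquad K(\pi_T,\mathcal H)=\sup_{h\in\mathcal H}K(\pi_T,h).$$ There are an absolute constant $C$, a polynomial $q$ and a single algorithm such that, for all $\mathcal X,\mathcal H,B,\beta,\mathcal H_\beta,T$ as above and against every such adversary, the algorithm, given $T$, $N$, $B$ and, in each round $t$, access to the values $h^1(x_t),\dots,h^N(x_t)$, satisfies $$\mathbb E\big[K(\pi_T,\mathcal H)\big]\;\le\; C\,B\,T^{-1/3}\sqrt{\log\big(6T|\mathcal H_\beta|\big)}+\beta ,$$ and its total running time over the $T$ rounds is at most $|\mathcal H_\beta|\cdot q(T)$ on every transcript. Running time is counted on a real RAM: one step for each arithmetic operation, comparison, memory access, and evaluation of some $h^i$ at the current context $x_t$, and $m+1$ steps for drawing a forecast from $w_t$. -/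

import Mathlib

/-! ## Machine model: a real RAM with structured control flow

The memory holds natural-number index registers and finitely many named (two-dimensional) arrays
of real numbers.  Every arithmetic operation, comparison, memory access and query costs one step;
a program is a finite text that does not depend on the input. -/

namespace RealRAM

/-- Memory: index registers `nat r` and array cells `arr a i j`. -/
structure State where
  nat : ℕ → ℕ
  arr : ℕ → ℕ → ℕ → ℝ

/-- Index expressions: literals, registers, sums and truncated differences. -/
inductive NExpr where
  | lit (n : ℕ)
  | reg (r : ℕ)
  | add (e₁ e₂ : NExpr)
  | sub (e₁ e₂ : NExpr)

namespace NExpr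

/-- Value of an index expression. -/
def eval (s : State) : NExpr → ℕ
  | lit n => n
  | reg r => s.nat r
  | add e₁ e₂ => eval s e₁ + eval s e₂
  | sub e₁ e₂ => eval s e₁ - eval s e₂

/-- Number of operations in an index expression. -/
def size : NExpr → ℕ
  | lit _ => 1
  | reg _ => 1
  | add e₁ e₂ => size e₁ + size e₂ + 1
  | sub e₁ e₂ => size e₁ + size e₂ + 1

end NExpr

/-- Real expressions: rational literals, conversion of an index, array cells, queries to the
current oracle, and the four arithmetic operations. -/
inductive RExpr where
  | lit (c : ℚ)
  | ofIndex (e : NExpr)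
  | cell (a : ℕ) (i j : NExpr)
  | query (i : NExpr)
  | add (e₁ e₂ : RExpr)
  | sub (e₁ e₂ : RExpr)
  | mul (e₁ e₂ : RExpr)
  | div (e₁ e₂ : RExpr)

namespace RExpr

/-- Value of a real expression; `orc` is the current oracle. -/
noncomputable def eval (orc : ℕ → ℝ) (s : State) : RExpr → ℝ
  | lit c => (c : ℝ)
  | ofIndex e => (e.eval s : ℝ)
  | cell a i j => s.arr a (i.eval s) (j.eval s)
  | query i => orc (i.eval s)
  | add e₁ e₂ => eval orc s e₁ + eval orc s e₂
  | sub e₁ e₂ => eval orc s e₁ - eval orc s e₂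
  | mul e₁ e₂ => eval orc s e₁ * eval orc s e₂
  | div e₁ e₂ => eval orc s e₁ / eval orc s e₂

/-- Number of operations in a real expression. -/
def size : RExpr → ℕ
  | lit _ => 1
  | ofIndex e => e.size + 1
  | cell _ i j => i.size + j.size + 1
  | query i => i.size + 1
  | add e₁ e₂ => size e₁ + size e₂ + 1
  | sub e₁ e₂ => size e₁ + size e₂ + 1
  | mul e₁ e₂ => size e₁ + size e₂ + 1
  | div e₁ e₂ => size e₁ + size e₂ + 1

end RExpr

/-- Store the index `n` in register `r`. -/
def State.setNat (s : State) (r n : ℕ) : State where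
  nat := fun r' => if r' = r then n else s.nat r'
  arr := s.arr

/-- Store the real `v` in the cell `(i, j)` of array `a`. -/
def State.setArr (s : State) (a i j : ℕ) (v : ℝ) : State where
  nat := s.nat
  arr := fun a' i' j' => if a' = a ∧ i' = i ∧ j' = j then v else s.arr a' i' j'

/-- Programs.  `loop e p` runs `p` as many times as the value of `e` on entry. -/
inductive Prog where
  | skip
  | setNat (r : ℕ) (e : NExpr)
  | setArr (a : ℕ) (i j : NExpr) (e : RExpr)
  | seq (p₁ p₂ : Prog)
  | iteNat (e₁ e₂ : NExpr) (p₁ p₂ : Prog)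
  | iteReal (e₁ e₂ : RExpr) (p₁ p₂ : Prog)
  | loop (e : NExpr) (p : Prog)

namespace Prog

/-- The memory after running a program.  The conditionals test `e₁ ≤ e₂`. -/
noncomputable def exec (orc : ℕ → ℝ) : Prog → State → State
  | skip, s => s
  | setNat r e, s => s.setNat r (e.eval s)
  | setArr a i j e, s => s.setArr a (i.eval s) (j.eval s) (e.eval orc s)
  | seq p₁ p₂, s => exec orc p₂ (exec orc p₁ s)
  | iteNat e₁ e₂ p₁ p₂, s => if e₁.eval s ≤ e₂.eval s then exec orc p₁ s else exec orc p₂ s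
  | iteReal e₁ e₂ p₁ p₂, s =>
      if e₁.eval orc s ≤ e₂.eval orc s then exec orc p₁ s else exec orc p₂ s
  | loop e p, s => (exec orc p)^[e.eval s] s

/-- The number of steps of a run of a program. -/
noncomputable def time (orc : ℕ → ℝ) : Prog → State → ℕ
  | skip, _ => 1
  | setNat _ e, _ => e.size + 1
  | setArr _ i j e, _ => i.size + j.size + e.size + 1
  | seq p₁ p₂, s => time orc p₁ s + time orc p₂ (exec orc p₁ s)
  | iteNat e₁ e₂ p₁ p₂, s => e₁.size + e₂.size + 1 +
      (if e₁.eval s ≤ e₂.eval s then time orc p₁ s else time orc p₂ s)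
  | iteReal e₁ e₂ p₁ p₂, s => e₁.size + e₂.size + 1 +
      (if e₁.eval orc s ≤ e₂.eval orc s then time orc p₁ s else time orc p₂ s)
  | loop e p, s => e.size + 1 +
      ∑ k ∈ Finset.range (e.eval s), (1 + time orc p ((exec orc p)^[k] s))

end Prog

end RealRAM

/-! ## Online multicalibration -/

namespace Multicalibration

open RealRAM

/-- One round of a transcript: the context `x`, the label `y ∈ [0, 1]`, and the index `p` of the
forecast `p / m ∈ {0, 1/m, …, 1}`. -/
structure Round (X : Type*) (m : ℕ) where
  x : X
  y : unitInterval
  p : Fin (m + 1)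

/-- Histories list their rounds with the most recent one first. -/
abbrev History (X : Type*) (m : ℕ) := List (Round X m)

/-- A deterministic adaptive adversary picks the context and the label of the next round from the
whole past, before the forecast of that round is drawn. -/
abbrev Adversary (X : Type*) (m : ℕ) := History X m → X × unitInterval

/-- `K(π, h) = ∑_p (1/T) |∑_{t : p_t = p} h(x_t) (y_t - p_t)|`, where `T` is the length of `π`. -/
noncomputable def calError {X : Type*} {m : ℕ} (π : History X m) (h : X → ℝ) : ℝ :=
  ∑ i : Fin (m + 1), (1 / (π.length : ℝ)) *
    |((π.filter fun r => r.p = i).map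
        fun r => h r.x * ((r.y : ℝ) - ((r.p : ℕ) : ℝ) / (m : ℝ))).sum|

/-- `K(π, H) = sup_{h ∈ H} K(π, h)`. -/
noncomputable def multicalError {X : Type*} {m : ℕ} (π : History X m) (H : Set (X → ℝ)) : ℝ :=
  ⨆ h : H, calError π (h : X → ℝ)

/-- The expected value of `F` at the final transcript, when the history so far is `π`, there are
`n` more rounds, the adversary is `A`, and in every round the forecast has index `i` with
conditional probability `w π x i` given the past history `π` and the present context `x`. -/
noncomputable def expectedValue {X : Type*} {m : ℕ} (w : History X m → X → Fin (m + 1) → ℝ)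
    (A : Adversary X m) (F : History X m → ℝ) : ℕ → History X m → ℝ
  | 0, π => F π
  | n + 1, π => ∑ i : Fin (m + 1),
      w π (A π).1 i * expectedValue w A F n (⟨(A π).1, (A π).2, i⟩ :: π)

/-- `S` is a (finite) `β`-cover of `H` in the `L∞` metric. -/
def IsCover {X : Type*} (H : Set (X → ℝ)) (β : ℝ) (S : Finset (X → ℝ)) : Prop :=
  (S : Set (X → ℝ)) ⊆ H ∧ ∀ h ∈ H, ∃ g ∈ S, ∀ x, |h x - g x| ≤ β

/-- `S` is a `β`-cover of `H` of the smallest possible size. -/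
def IsMinimalCover {X : Type*} (H : Set (X → ℝ)) (β : ℝ) (S : Finset (X → ℝ)) : Prop :=
  IsCover H β S ∧ ∀ S' : Finset (X → ℝ), IsCover H β S' → S.card ≤ S'.card

/-- An online forecasting algorithm: a program that runs before the first round, one that runs in
each round after the context is revealed, and one that runs after the label is revealed. -/
structure Algorithm where
  init : Prog
  predict : Prog
  update : Prog

namespace Algorithm

/-- The input: the horizon `T` (register 0), the number `N` of available functions (register 1)
and their bound `B` (cell `(0, 0)` of array 0); everything else is zero. -/
noncomputable def input (T N : ℕ) (B : ℝ) : State where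
  nat := fun r => if r = 0 then T else if r = 1 then N else 0
  arr := fun a i j => if a = 0 ∧ i = 0 ∧ j = 0 then B else 0

/-- In a round with context `x`, query `i` returns the value at `x` of the `i`-th function. -/
def oracle {X : Type*} {N : ℕ} (g : Fin N → X → ℝ) (x : X) (i : ℕ) : ℝ :=
  if hi : i < N then g ⟨i, hi⟩ x else 0

/-- The memory before the first round (no context is available yet). -/
noncomputable def startState (alg : Algorithm) (T N : ℕ) (B : ℝ) : State :=
  alg.init.exec (fun _ => 0) (input T N B)

/-- The discretization parameter `m` chosen by the algorithm (register 2 before round one). -/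
noncomputable def discretization (alg : Algorithm) (T N : ℕ) (B : ℝ) : ℕ :=
  (alg.startState T N B).nat 2

/-- The memory just before the update, in a round that began with memory `s`: the forecast
index (register 3) and the label (cell `(0, 1)` of array 0) have been stored. -/
noncomputable def beforeUpdate {X : Type*} {m N : ℕ} (alg : Algorithm) (g : Fin N → X → ℝ)
    (s : State) (r : Round X m) : State :=
  ((alg.predict.exec (oracle g r.x) s).setNat 3 r.p).setArr 0 0 1 r.y

/-- The memory after a given history. -/
noncomputable def stateAfter {X : Type*} {m N : ℕ} (alg : Algorithm) (g : Fin N → X → ℝ)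
    (T : ℕ) (B : ℝ) : History X m → State
  | [] => alg.startState T N B
  | r :: π => alg.update.exec (oracle g r.x) (alg.beforeUpdate g (stateAfter alg g T B π) r)

/-- The forecast weights `w(0), …, w(m)` that the algorithm selects after history `π` at context
`x`: the cells `(0, 0), …, (0, m)` of array 1 when the prediction program ends. -/
noncomputable def weights {X : Type*} {m N : ℕ} (alg : Algorithm) (g : Fin N → X → ℝ)
    (T : ℕ) (B : ℝ) (π : History X m) (x : X) (i : Fin (m + 1)) : ℝ :=
  (alg.predict.exec (oracle g x) (alg.stateAfter g T B π)).arr 1 0 i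

/-- The total number of steps along a given history.  Drawing the forecast from the selected
weights is charged `m + 1` steps per round. -/
noncomputable def runTime {X : Type*} {m N : ℕ} (alg : Algorithm) (g : Fin N → X → ℝ)
    (T : ℕ) (B : ℝ) : History X m → ℕ
  | [] => alg.init.time (fun _ => 0) (input T N B)
  | r :: π => runTime alg g T B π
      + alg.predict.time (oracle g r.x) (alg.stateAfter g T B π)
      + (m + 1)
      + alg.update.time (oracle g r.x) (alg.beforeUpdate g (alg.stateAfter g T B π) r)

/-- `E[K(π_T, H)]` for the algorithm against a deterministic adaptive adversary. -/
noncomputable def expectedError {X : Type*} {m N : ℕ} (alg : Algorithm) (g : Fin N → X → ℝ)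
    (T : ℕ) (B : ℝ) (H : Set (X → ℝ)) (A : Adversary X m) : ℝ :=
  expectedValue (alg.weights g T B) A (fun π => multicalError π H) T []

end Algorithm

end Multicalibration

/-! Treat every pair of a cover function `h` and a sign vector `σ ∈ {±1}^(m+1)` as an expert of
weight `∏ (1 + σ_{p_t} z_t)`, where `z_t` is `h(x_t)(y_t - p_t)` divided by `2Bm`. Since `T K(π, h)`
is the maximum over `σ` of `∑ σ_{p_t} h(x_t)(y_t - p_t)`, a bound for the total weight of the
experts bounds `K`. The average over `σ` factors into `∏_j (W_j⁺ + W_j⁻) / 2`, so one potential and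
`m + 1` ratios per function replace `2^(m+1)` experts; this makes the running time linear in `N`
(`potential_mul_prod`).

A round with forecast `j` multiplies a potential by `1 + z R_j`, so the total potential changes by a
multiple of `(y - j/m) F(j)`, where `F` is the potential-weighted sum of the `h(x) R_j`. Either
`F(0) ≤ 0`, or `F(m) > 0`, or `F` changes sign between two neighbouring forecasts. In the last case,
randomizing between the neighbours so that `F` has mean zero cancels the unknown label and leaves
only a grid error of order `1/m` (`IsBalanced`). Hence the expected total potential grows at most by
the factor `1 + 1/(2m²)` per round (`sum_potential_step`).

The inequality `exp(z - 2z²) ≤ 1 + z` turns potentials back into calibration errors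
(`calError_le_log_potential`), and `expectedError_le_log` gives `(2Bm/T)(log N + (m+1) log 2 + T/m²)
+ β`; the `β` is the price of the cover, because `|y - p| ≤ 1`. The choice `m = ⌊T^(1/3)⌋` balances
the last two terms, and the trivial bound `B` covers the case of a very large `log N`. -/

namespace RealRAM

/-! ### Reasoning rules for programs and memory. -/

/-- The loop rule: an invariant indexed by the number of completed iterations, together with a
bound for the time of one iteration. -/
theorem Prog.loop_spec {orc : ℕ → ℝ} {e : NExpr} {p : Prog} {s : State} {n c : ℕ}
    (I : ℕ → State → Prop) (hn : e.eval s = n) (h0 : I 0 s)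
    (hstep : ∀ k < n, ∀ s', I k s' → I (k + 1) (p.exec orc s') ∧ p.time orc s' ≤ c) :
    I n ((Prog.loop e p).exec orc s) ∧
      (Prog.loop e p).time orc s ≤ e.size + 1 + n * (1 + c) := by
  have key : ∀ k ≤ n, I k ((p.exec orc)^[k] s) := by
    intro k
    induction k with
    | zero => intro _; exact h0
    | succ k ih =>
      intro hk
      rw [Function.iterate_succ_apply']
      exact (hstep k hk _ (ih (Nat.le_of_lt hk))).1
  refine ⟨?_, ?_⟩
  · simp only [Prog.exec, hn]
    exact key n le_rfl
  · simp only [Prog.time, hn]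
    gcongr
    calc _ ≤ ∑ _k ∈ Finset.range n, (1 + c) := by
          refine Finset.sum_le_sum fun k hk => ?_
          have hk := Finset.mem_range.1 hk
          have := (hstep k hk _ (key k hk.le)).2
          omega
      _ = n * (1 + c) := by simp

theorem State.setNat_nat (s : State) (r n r' : ℕ) :
    (s.setNat r n).nat r' = if r' = r then n else s.nat r' := rfl

theorem State.setNat_arr (s : State) (r n : ℕ) : (s.setNat r n).arr = s.arr := rfl

theorem State.setArr_nat (s : State) (a i j : ℕ) (v : ℝ) : (s.setArr a i j v).nat = s.nat := rfl

theorem State.setArr_arr (s : State) (a i j : ℕ) (v : ℝ) (a' i' j' : ℕ) :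
    (s.setArr a i j v).arr a' i' j' =
      if a' = a ∧ i' = i ∧ j' = j then v else s.arr a' i' j' := rfl

end RealRAM

namespace Multicalibration

open RealRAM

/-! ### Choice of the discretization. -/

/-- Stores the integer cube root of the horizon in register 2. -/
def cubeRootProg : Prog :=
  .loop (.reg 0)
    (.iteReal
      (.mul (.mul (.ofIndex (.add (.reg 2) (.lit 1))) (.ofIndex (.add (.reg 2) (.lit 1))))
        (.ofIndex (.add (.reg 2) (.lit 1))))
      (.ofIndex (.reg 0))
      (.setNat 2 (.add (.reg 2) (.lit 1)))
      .skip)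

theorem cubeRootProg_spec (orc : ℕ → ℝ) (s : State) (hs : s.nat 2 = 0) :
    (((cubeRootProg.exec orc s).nat 2 ^ 3 ≤ s.nat 0 ∧
        s.nat 0 < ((cubeRootProg.exec orc s).nat 2 + 1) ^ 3) ∧
      (∀ r, r ≠ 2 → (cubeRootProg.exec orc s).nat r = s.nat r) ∧
      (cubeRootProg.exec orc s).arr = s.arr) ∧
    cubeRootProg.time orc s ≤ 2 + s.nat 0 * 25 := by
  have h := Prog.loop_spec (orc := orc) (e := .reg 0) (s := s) (n := s.nat 0) (c := 24)
    (p := .iteReal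
      (.mul (.mul (.ofIndex (.add (.reg 2) (.lit 1))) (.ofIndex (.add (.reg 2) (.lit 1))))
        (.ofIndex (.add (.reg 2) (.lit 1))))
      (.ofIndex (.reg 0)) (.setNat 2 (.add (.reg 2) (.lit 1))) .skip)
    -- Either every iteration so far has incremented the register, or it has stopped for good at the
    -- cube root. After `T` iterations the first alternative also suffices, as `T < (T + 1) ^ 3`.
    (fun k s' => (s'.nat 2 ^ 3 ≤ s.nat 0 ∧ (s'.nat 2 = k ∨ s.nat 0 < (s'.nat 2 + 1) ^ 3)) ∧
      (∀ r, r ≠ 2 → s'.nat r = s.nat r) ∧ s'.arr = s.arr) rfl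
    (by simp [hs]) ?_
  · obtain ⟨⟨⟨h1, h2⟩, h3⟩, h4⟩ := h
    refine ⟨⟨⟨h1, ?_⟩, h3⟩, h4⟩
    rcases h2 with h2 | h2
    · unfold cubeRootProg
      rw [h2]
      exact (Nat.lt_succ_self _).trans_le (Nat.le_self_pow (by norm_num) _)
    · exact h2
  · rintro k - s' ⟨⟨h1, h2⟩, h3, h4⟩
    have e0 : s'.nat 0 = s.nat 0 := h3 0 (by norm_num)
    have hc : (((s'.nat 2 + 1 : ℕ) : ℝ) * ((s'.nat 2 + 1 : ℕ) : ℝ) * ((s'.nat 2 + 1 : ℕ) : ℝ)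
        ≤ ((s'.nat 0 : ℕ) : ℝ)) ↔ (s'.nat 2 + 1) ^ 3 ≤ s.nat 0 := by
      rw [e0, ← Nat.cast_mul, ← Nat.cast_mul, Nat.cast_le, pow_succ, pow_two]
    simp only [Prog.exec, Prog.time, RExpr.eval, NExpr.eval, RExpr.size, NExpr.size, hc]
    by_cases hle : (s'.nat 2 + 1) ^ 3 ≤ s.nat 0
    · simp only [hle, if_true, State.setNat_nat, State.setNat_arr, h4]
      refine ⟨⟨⟨trivial, ?_⟩, ?_, trivial⟩, by norm_num⟩
      · rcases h2 with h2 | h2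
        · left; omega
        · omega
      · intro r hr
        simp [hr, h3 r hr]
    · simp only [hle, if_false, h4]
      refine ⟨⟨⟨h1, Or.inr (by omega)⟩, h3, trivial⟩, by norm_num⟩

/-! ### Computing the scores of the forecasts. -/

/-- One coordinate of the score: adds `∑ i < N, (1 + V i) * h i * R i j` to cell `(0, j)` of
array 4, where `j` is register 5, `V` is array 3 and `R` is array 2. -/
def scoreBody : Prog :=
  .seq
    (.setArr 4 (.lit 0) (.reg 5)
      (.add (.cell 4 (.lit 0) (.reg 5))
        (.mul (.mul (.add (.lit 1) (.cell 3 (.reg 4) (.lit 0))) (.query (.reg 4)))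
          (.cell 2 (.reg 4) (.reg 5)))))
    (.setNat 4 (.add (.reg 4) (.lit 1)))

/-- Clears the weights and computes the scores of all forecasts. -/
def scoreProg : Prog :=
  .seq (.setNat 5 (.lit 0))
    (.loop (.add (.reg 2) (.lit 1))
      (.seq (.setArr 1 (.lit 0) (.reg 5) (.lit 0))
        (.seq (.setArr 4 (.lit 0) (.reg 5) (.lit 0))
          (.seq (.setNat 4 (.lit 0))
            (.seq (.loop (.reg 1) scoreBody)
              (.setNat 5 (.add (.reg 5) (.lit 1))))))))

/-- The score of the forecast with index `j`. -/
noncomputable def score (orc : ℕ → ℝ) (s : State) (n j : ℕ) : ℝ :=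
  ∑ i ∈ Finset.range n, (1 + s.arr 3 i 0) * orc i * s.arr 2 i j

theorem scoreLoop_spec (orc : ℕ → ℝ) (s : State) (h4 : s.nat 4 = 0)
    (hz : s.arr 4 0 (s.nat 5) = 0) :
    ((∀ r, r ≠ 4 → ((Prog.loop (.reg 1) scoreBody).exec orc s).nat r = s.nat r) ∧
      ∀ a i j, ((Prog.loop (.reg 1) scoreBody).exec orc s).arr a i j =
        if a = 4 ∧ i = 0 ∧ j = s.nat 5 then score orc s (s.nat 1) j else s.arr a i j) ∧
    (Prog.loop (.reg 1) scoreBody).time orc s ≤ 2 + s.nat 1 * 24 := by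
  have h := Prog.loop_spec (orc := orc) (e := .reg 1) (s := s) (n := s.nat 1) (c := 23)
    (p := scoreBody)
    (fun k s' => s'.nat 4 = k ∧ (∀ r, r ≠ 4 → s'.nat r = s.nat r) ∧
      ∀ a i j, s'.arr a i j =
        if a = 4 ∧ i = 0 ∧ j = s.nat 5 then score orc s k j else s.arr a i j) rfl
    ⟨h4, fun _ _ => rfl, by
      intro a i j
      split_ifs with hc
      · obtain ⟨rfl, rfl, rfl⟩ := hc
        simpa [score] using hz
      · rfl⟩ ?_
  · exact ⟨h.1.2, h.2⟩
  · rintro k - s' ⟨h1, h2, h3⟩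
    have e5 : s'.nat 5 = s.nat 5 := h2 5 (by norm_num)
    simp only [scoreBody, Prog.exec, Prog.time, RExpr.eval, NExpr.eval, RExpr.size, NExpr.size,
      State.setNat_nat, State.setNat_arr, State.setArr_nat, State.setArr_arr, h1, e5]
    refine ⟨⟨by simp, fun r hr => by simp [hr, h2 r hr], fun a i j => ?_⟩, by norm_num⟩
    by_cases hc : a = 4 ∧ i = 0 ∧ j = s.nat 5
    · obtain ⟨rfl, rfl, rfl⟩ := hc
      simp [h3, score, Finset.sum_range_succ]
    · rw [if_neg hc, if_neg hc, h3, if_neg hc]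

theorem scoreProg_spec (orc : ℕ → ℝ) (s : State) :
    ((∀ r, r < 3 → (scoreProg.exec orc s).nat r = s.nat r) ∧
      (∀ a i j, a ≠ 1 → a ≠ 4 → (scoreProg.exec orc s).arr a i j = s.arr a i j) ∧
      ∀ j ≤ s.nat 2, (scoreProg.exec orc s).arr 1 0 j = 0 ∧
        (scoreProg.exec orc s).arr 4 0 j = score orc s (s.nat 1) j) ∧
    scoreProg.time orc s ≤ 6 + (s.nat 2 + 1) * (18 + s.nat 1 * 24) := by
  have h := Prog.loop_spec (orc := orc) (e := .add (.reg 2) (.lit 1)) (s := s.setNat 5 0)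
    (n := s.nat 2 + 1) (c := 17 + s.nat 1 * 24)
    (p := .seq (.setArr 1 (.lit 0) (.reg 5) (.lit 0))
        (.seq (.setArr 4 (.lit 0) (.reg 5) (.lit 0))
          (.seq (.setNat 4 (.lit 0))
            (.seq (.loop (.reg 1) scoreBody)
              (.setNat 5 (.add (.reg 5) (.lit 1)))))))
    (fun k s' => s'.nat 5 = k ∧ (∀ r, r < 3 → s'.nat r = s.nat r) ∧
      (∀ a i j, a ≠ 1 → a ≠ 4 → s'.arr a i j = s.arr a i j) ∧
      ∀ j < k, s'.arr 1 0 j = 0 ∧ s'.arr 4 0 j = score orc s (s.nat 1) j) rfl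
    ⟨rfl, fun r hr => by simp [State.setNat_nat]; omega, fun _ _ _ _ _ => rfl, by simp⟩ ?_
  · obtain ⟨⟨-, h1, h2, h3⟩, h4⟩ := h
    refine ⟨⟨h1, h2, fun j hj => h3 j (by omega)⟩, ?_⟩
    simp only [NExpr.size] at h4
    simp only [scoreProg, Prog.time, NExpr.size, Prog.exec, NExpr.eval]
    refine (Nat.add_le_add_left h4 _).trans (le_of_eq ?_)
    ring
  · rintro k - s' ⟨h1, h2, h3, h4⟩
    set u : State := ((s'.setArr 1 0 k 0).setArr 4 0 k 0).setNat 4 0 with hu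
    have hl := scoreLoop_spec orc u rfl (by simp [hu, State.setNat_arr, State.setArr_arr,
      State.setNat_nat, State.setArr_nat, h1])
    have u5 : u.nat 5 = k := by simp [hu, State.setNat_nat, State.setArr_nat, h1]
    have u1 : u.nat 1 = s.nat 1 := by simp [hu, State.setNat_nat, State.setArr_nat, h2]
    have usc : ∀ j, score orc u (s.nat 1) j = score orc s (s.nat 1) j := by
      intro j
      refine Finset.sum_congr rfl fun i _ => ?_
      simp [hu, State.setNat_arr, State.setArr_arr, h3]
    rw [u5, u1] at hl
    obtain ⟨⟨l1, l2⟩, l3⟩ := hl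
    have hex : ∀ q : Prog, (Prog.seq (.setArr 1 (.lit 0) (.reg 5) (.lit 0))
        (.seq (.setArr 4 (.lit 0) (.reg 5) (.lit 0)) (.seq (.setNat 4 (.lit 0)) q))).exec orc s' =
        q.exec orc u := by
      intro q
      simp [Prog.exec, hu, NExpr.eval, RExpr.eval, State.setArr_nat, h1]
    have htm : ∀ q : Prog, (Prog.seq (.setArr 1 (.lit 0) (.reg 5) (.lit 0))
        (.seq (.setArr 4 (.lit 0) (.reg 5) (.lit 0)) (.seq (.setNat 4 (.lit 0)) q))).time orc s' =
        4 + (4 + (2 + q.time orc u)) := by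
      intro q
      simp [Prog.exec, Prog.time, hu, NExpr.eval, RExpr.eval, State.setArr_nat, h1, NExpr.size,
        RExpr.size]
    rw [hex, htm]
    simp only [Prog.exec] at l1 l2
    simp only [Prog.exec, State.setNat_nat, State.setNat_arr]
    refine ⟨⟨?_, fun r hr => ?_, fun a i j ha1 ha4 => ?_, fun j hj => ?_⟩, ?_⟩
    · simp only [NExpr.eval, if_true] at l1 ⊢
      rw [l1 5 (by norm_num), u5]
    · rw [if_neg (by omega), l1 r (by omega)]
      simp only [hu, State.setNat_nat, State.setArr_nat]
      rw [if_neg (by omega), h2 r hr]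
    · rw [l2, if_neg (by tauto)]
      simp [hu, State.setNat_arr, State.setArr_arr, ha1, ha4, h3]
    · rw [l2, l2]
      rcases Nat.lt_succ_iff_lt_or_eq.1 hj with hj | rfl
      · simp [hu, State.setNat_arr, State.setArr_arr, hj.ne, h4 j hj]
      · simp [hu, State.setNat_arr, State.setArr_arr, ← usc]
    · simp only [Prog.time, NExpr.size] at l3 ⊢
      omega

/-! ### Locating the sign change of the scores. -/

/-- Stores in register 6 the first index at which array 4 is non-positive. -/
def signChangeProg : Prog :=
  .seq (.setNat 6 (.lit 0))
    (.loop (.add (.reg 2) (.lit 1))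
      (.iteReal (.cell 4 (.lit 0) (.reg 6)) (.lit 0) .skip
        (.setNat 6 (.add (.reg 6) (.lit 1)))))

theorem signChangeProg_spec (orc : ℕ → ℝ) (s : State) :
    ((∀ r, r < 3 → (signChangeProg.exec orc s).nat r = s.nat r) ∧
      (signChangeProg.exec orc s).arr = s.arr ∧
      (signChangeProg.exec orc s).nat 6 ≤ s.nat 2 + 1 ∧
      (∀ i < (signChangeProg.exec orc s).nat 6, 0 < s.arr 4 0 i) ∧
      ((signChangeProg.exec orc s).nat 6 < s.nat 2 + 1 →
        s.arr 4 0 ((signChangeProg.exec orc s).nat 6) ≤ 0)) ∧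
    signChangeProg.time orc s ≤ 6 + (s.nat 2 + 1) * 10 := by
  have h := Prog.loop_spec (orc := orc) (e := .add (.reg 2) (.lit 1)) (s := s.setNat 6 0)
    (n := s.nat 2 + 1) (c := 9)
    (p := .iteReal (.cell 4 (.lit 0) (.reg 6)) (.lit 0) .skip
        (.setNat 6 (.add (.reg 6) (.lit 1))))
    (fun k s' => (∀ r, r < 3 → s'.nat r = s.nat r) ∧ s'.arr = s.arr ∧ s'.nat 6 ≤ k ∧
      (∀ i < s'.nat 6, 0 < s.arr 4 0 i) ∧ (s'.nat 6 < k → s.arr 4 0 (s'.nat 6) ≤ 0)) rfl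
    ⟨fun r hr => by simp [State.setNat_nat]; omega, rfl, le_rfl,
      by simp [State.setNat_nat], by simp [State.setNat_nat]⟩ ?_
  · refine ⟨h.1, ?_⟩
    have h2 := h.2
    simp only [NExpr.size] at h2
    simp only [signChangeProg, Prog.time, NExpr.size, Prog.exec, NExpr.eval]
    refine (Nat.add_le_add_left h2 _).trans (le_of_eq ?_)
    ring
  · rintro k - s' ⟨h1, h2, h3, h4, h5⟩
    simp only [Prog.exec, Prog.time, RExpr.eval, NExpr.eval, RExpr.size, NExpr.size, h2,
      Rat.cast_zero]
    by_cases hle : s.arr 4 0 (s'.nat 6) ≤ 0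
    · simp only [hle, if_true]
      exact ⟨⟨h1, h2, by omega, h4, fun _ => trivial⟩, by norm_num⟩
    · simp only [hle, if_false, State.setNat_nat, State.setNat_arr]
      -- The register stalls forever at the first non-positive score, so a positive score there
      -- means that it has advanced in every iteration.
      have hk : s'.nat 6 = k := by
        by_contra hne
        exact hle (h5 (by omega))
      refine ⟨⟨fun r hr => ?_, h2, by simp [hk], fun i hi => ?_, by simp [hk]⟩, by norm_num⟩
      · rw [if_neg (by omega), h1 r hr]
      · simp only [if_true] at hi
        rcases Nat.lt_succ_iff_lt_or_eq.1 hi with hi | rfl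
        · exact h4 i hi
        · exact not_le.1 hle

/-! ### Balanced forecast distributions. -/

/-- A probability vector `w` on `{0, …, m}` for which `∑ w j * (y - j / m) * F j` is at most
`max |F| / m` for every label `y`. -/
structure IsBalanced (m : ℕ) (F w : ℕ → ℝ) : Prop where
  nonneg : ∀ j ≤ m, 0 ≤ w j
  sum_eq : ∑ j ∈ Finset.range (m + 1), w j = 1
  sum_le : ∀ y : ℝ, 0 ≤ y → y ≤ 1 → ∀ M : ℝ, (∀ j ≤ m, |F j| ≤ M) →
    ∑ j ∈ Finset.range (m + 1), w j * ((y - j / m) * F j) ≤ M / m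

/-- Forecast 0 cannot exceed the label, so `y - 0 ≥ 0` meets a non-positive score. -/
theorem IsBalanced.single_zero {m : ℕ} {F w : ℕ → ℝ} (hF : F 0 ≤ 0)
    (hw : ∀ j ≤ m, w j = if j = 0 then 1 else 0) : IsBalanced m F w where
  nonneg j hj := by rw [hw j hj]; split_ifs <;> norm_num
  sum_eq := by
    rw [Finset.sum_congr rfl fun j hj => hw j (Nat.lt_succ_iff.1 (Finset.mem_range.1 hj))]
    simp
  sum_le y hy _ M hM := by
    rw [Finset.sum_congr rfl fun j hj => by
      rw [hw j (Nat.lt_succ_iff.1 (Finset.mem_range.1 hj))]]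
    have hM0 : 0 ≤ M := (abs_nonneg _).trans (hM 0 (Nat.zero_le _))
    simp only [ite_mul, one_mul, zero_mul, Finset.sum_ite_eq', Finset.mem_range]
    rw [if_pos (Nat.succ_pos m)]
    have : 0 ≤ M / m := by positivity
    simp only [Nat.cast_zero, zero_div, sub_zero]
    nlinarith

/-- Forecast 1 is never below the label, so `y - 1 ≤ 0` meets a non-negative score. -/
theorem IsBalanced.single_last {m : ℕ} {F w : ℕ → ℝ} (hm : 0 < m) (hF : 0 ≤ F m)
    (hw : ∀ j ≤ m, w j = if j = m then 1 else 0) : IsBalanced m F w where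
  nonneg j hj := by rw [hw j hj]; split_ifs <;> norm_num
  sum_eq := by
    rw [Finset.sum_congr rfl fun j hj => hw j (Nat.lt_succ_iff.1 (Finset.mem_range.1 hj))]
    simp
  sum_le y _ hy M hM := by
    rw [Finset.sum_congr rfl fun j hj => by
      rw [hw j (Nat.lt_succ_iff.1 (Finset.mem_range.1 hj))]]
    have hM0 : 0 ≤ M := (abs_nonneg _).trans (hM 0 (Nat.zero_le _))
    simp only [ite_mul, one_mul, zero_mul, Finset.sum_ite_eq', Finset.mem_range]
    rw [if_pos (Nat.lt_succ_self m)]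
    have : 0 ≤ M / m := by positivity
    rw [div_self (by positivity)]
    nlinarith

/-- The weights make the mean of `F` vanish, so `y` and the common part `k / m` drop out. Only the
extra `1 / m` at the forecast `k + 1` survives, multiplied by `-w (k + 1) * F (k + 1) = w k * F k`.
-/
theorem IsBalanced.pair {m k : ℕ} {F w : ℕ → ℝ} (hk : k + 1 ≤ m) (hF : 0 < F k)
    (hF' : F (k + 1) ≤ 0)
    (hw : ∀ j ≤ m, w j = if j = k then -F (k + 1) / (F k - F (k + 1)) else
      if j = k + 1 then F k / (F k - F (k + 1)) else 0) : IsBalanced m F w := by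
  have hd : 0 < F k - F (k + 1) := by linarith
  have hsum : ∀ G : ℕ → ℝ, ∑ j ∈ Finset.range (m + 1), w j * G j =
      -F (k + 1) / (F k - F (k + 1)) * G k + F k / (F k - F (k + 1)) * G (k + 1) := by
    intro G
    have : ∀ j ∈ Finset.range (m + 1), w j * G j =
        (if j = k then -F (k + 1) / (F k - F (k + 1)) * G k else 0) +
          (if j = k + 1 then F k / (F k - F (k + 1)) * G (k + 1) else 0) := by
      intro j hj
      rw [hw j (Nat.lt_succ_iff.1 (Finset.mem_range.1 hj))]
      by_cases h1 : j = k
      · subst h1; simp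
      · by_cases h2 : j = k + 1
        · subst h2; simp
        · simp [h1, h2]
    rw [Finset.sum_congr rfl this, Finset.sum_add_distrib, Finset.sum_ite_eq',
      Finset.sum_ite_eq', if_pos (by simp; omega), if_pos (by simp; omega)]
  refine ⟨fun j hj => ?_, ?_, fun y _ _ M hM => ?_⟩
  · rw [hw j hj]
    split_ifs
    · exact div_nonneg (by linarith) hd.le
    · exact div_nonneg hF.le hd.le
    · exact le_rfl
  · have := hsum fun _ => 1
    simp only [mul_one] at this
    rw [this]
    field_simp
    ring
  · rw [hsum]
    have hm : (0 : ℝ) < m := by exact_mod_cast (by omega : 0 < m)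
    have hM1 : F k ≤ M := (le_abs_self _).trans (hM k (by omega))
    have heq : -F (k + 1) / (F k - F (k + 1)) * ((y - k / m) * F k) +
        F k / (F k - F (k + 1)) * ((y - (k + 1 : ℕ) / m) * F (k + 1)) =
        (F k / m) * (-F (k + 1) / (F k - F (k + 1))) := by
      push_cast
      field_simp
      ring
    rw [heq]
    have h1 : -F (k + 1) / (F k - F (k + 1)) ≤ 1 := by
      rw [div_le_one hd]; linarith
    calc F k / m * (-F (k + 1) / (F k - F (k + 1))) ≤ F k / m * 1 := by gcongr
      _ ≤ M / m := by rw [mul_one]; gcongr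

/-- Writes the forecast weights, given the scores in array 4 and the first non-positive index in
register 6. -/
def weightProg : Prog :=
  .iteNat (.reg 6) (.lit 0) (.setArr 1 (.lit 0) (.lit 0) (.lit 1))
    (.iteNat (.add (.reg 2) (.lit 1)) (.reg 6) (.setArr 1 (.lit 0) (.reg 2) (.lit 1))
      (.seq
        (.setArr 1 (.lit 0) (.reg 6)
          (.div (.cell 4 (.lit 0) (.sub (.reg 6) (.lit 1)))
            (.sub (.cell 4 (.lit 0) (.sub (.reg 6) (.lit 1))) (.cell 4 (.lit 0) (.reg 6)))))
        (.setArr 1 (.lit 0) (.sub (.reg 6) (.lit 1))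
          (.div (.sub (.lit 0) (.cell 4 (.lit 0) (.reg 6)))
            (.sub (.cell 4 (.lit 0) (.sub (.reg 6) (.lit 1))) (.cell 4 (.lit 0) (.reg 6)))))))

theorem weightProg_spec (orc : ℕ → ℝ) (s : State) (hm : 0 < s.nat 2)
    (h0 : ∀ j ≤ s.nat 2, s.arr 1 0 j = 0) (h6 : s.nat 6 ≤ s.nat 2 + 1)
    (hpos : ∀ i < s.nat 6, 0 < s.arr 4 0 i)
    (hneg : s.nat 6 < s.nat 2 + 1 → s.arr 4 0 (s.nat 6) ≤ 0) :
    ((weightProg.exec orc s).nat = s.nat ∧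
      (∀ a i j, a ≠ 1 → (weightProg.exec orc s).arr a i j = s.arr a i j) ∧
      IsBalanced (s.nat 2) (s.arr 4 0) ((weightProg.exec orc s).arr 1 0)) ∧
    weightProg.time orc s ≤ 60 := by
  simp only [weightProg, Prog.exec, Prog.time, RExpr.eval, NExpr.eval, RExpr.size, NExpr.size,
    State.setArr_nat]
  by_cases c1 : s.nat 6 ≤ 0
  · simp only [c1, if_true, State.setArr_nat, State.setArr_arr]
    refine ⟨⟨trivial, fun a i j ha => by simp [ha], ?_⟩, by norm_num⟩
    have e6 : s.nat 6 = 0 := by omega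
    refine IsBalanced.single_zero (by simpa [e6] using hneg (by omega)) fun j hj => ?_
    simp [State.setArr_arr, h0 j hj]
  · simp only [c1, if_false]
    by_cases c2 : s.nat 2 + 1 ≤ s.nat 6
    · simp only [c2, if_true, State.setArr_nat, State.setArr_arr]
      refine ⟨⟨trivial, fun a i j ha => by simp [ha], ?_⟩, by norm_num⟩
      refine IsBalanced.single_last hm (hpos _ (by omega)).le fun j hj => ?_
      simp [State.setArr_arr, h0 j hj]
    · simp only [c2, if_false, State.setArr_nat, State.setArr_arr]
      refine ⟨⟨trivial, fun a i j ha => by simp [ha], ?_⟩, by norm_num⟩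
      obtain ⟨k, hk⟩ : ∃ k, s.nat 6 = k + 1 := ⟨s.nat 6 - 1, by omega⟩
      rw [hk] at hpos hneg c2 ⊢
      refine IsBalanced.pair (k := k) (by omega) (hpos k (by omega)) (hneg (by omega))
        fun j hj => ?_
      simp [State.setArr_arr, h0 j hj]

/-- Computes the forecast weights of a round. -/
def predictProg : Prog := .seq scoreProg (.seq signChangeProg weightProg)

theorem predictProg_spec (orc : ℕ → ℝ) (s : State) (hm : 0 < s.nat 2) :
    ((∀ r, r < 3 → (predictProg.exec orc s).nat r = s.nat r) ∧
      (∀ a i j, a ≠ 1 → a ≠ 4 → (predictProg.exec orc s).arr a i j = s.arr a i j) ∧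
      IsBalanced (s.nat 2) (score orc s (s.nat 1)) ((predictProg.exec orc s).arr 1 0)) ∧
    predictProg.time orc s ≤ 72 + (s.nat 2 + 1) * (28 + s.nat 1 * 24) := by
  obtain ⟨⟨a1, a2, a3⟩, a4⟩ := scoreProg_spec orc s
  set u := scoreProg.exec orc s with hu
  obtain ⟨⟨b1, b2, b3, b4, b5⟩, b6⟩ := signChangeProg_spec orc u
  set v := signChangeProg.exec orc u with hv
  have u2 : u.nat 2 = s.nat 2 := a1 2 (by norm_num)
  have v2 : v.nat 2 = u.nat 2 := b1 2 (by norm_num)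
  obtain ⟨⟨c1, c2, c3⟩, c4⟩ := weightProg_spec orc v (by omega)
    (fun j hj => by rw [b2]; exact (a3 j (by omega)).1) (by omega)
    (by rw [b2]; exact b4) (by rw [b2, v2]; exact b5)
  have hex : predictProg.exec orc s = weightProg.exec orc v := rfl
  have htm : predictProg.time orc s =
    scoreProg.time orc s + (signChangeProg.time orc u + weightProg.time orc v) := rfl
  rw [hex, htm]
  refine ⟨⟨fun r hr => by rw [c1, b1 r hr, a1 r hr],
    fun a i j h1 h4 => by rw [c2 a i j h1, b2, a2 a i j h1 h4], ?_⟩, ?_⟩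
  · rw [v2, u2, b2] at c3
    refine ⟨c3.nonneg, c3.sum_eq, fun y hy hy' M hM => ?_⟩
    have := c3.sum_le y hy hy' M fun j hj => by rw [(a3 j hj).2]; exact hM j hj
    rw [Finset.sum_congr rfl fun j hj => by
      rw [← (a3 j (Nat.lt_succ_iff.1 (Finset.mem_range.1 hj))).2]]
    exact this
  · rw [u2] at b6
    nlinarith

/-! ### Updating potentials and ratios. -/

/-- One step of the update, for the function whose index is register 4. -/
def updateBody : Prog :=
  .seq
    (.setArr 5 (.lit 0) (.lit 0)
      (.div
        (.mul (.query (.reg 4))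
          (.sub (.cell 0 (.lit 0) (.lit 1)) (.div (.ofIndex (.reg 3)) (.ofIndex (.reg 2)))))
        (.mul (.mul (.lit 2) (.cell 0 (.lit 0) (.lit 0))) (.ofIndex (.reg 2)))))
    (.seq
      (.setArr 3 (.reg 4) (.lit 0)
        (.add (.cell 3 (.reg 4) (.lit 0))
          (.mul (.add (.lit 1) (.cell 3 (.reg 4) (.lit 0)))
            (.mul (.cell 5 (.lit 0) (.lit 0)) (.cell 2 (.reg 4) (.reg 3))))))
      (.seq
        (.setArr 2 (.reg 4) (.reg 3)
          (.div (.add (.cell 2 (.reg 4) (.reg 3)) (.cell 5 (.lit 0) (.lit 0)))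
            (.add (.lit 1)
              (.mul (.cell 5 (.lit 0) (.lit 0)) (.cell 2 (.reg 4) (.reg 3))))))
        (.setNat 4 (.add (.reg 4) (.lit 1)))))

/-- Updates the ratios and the potentials after the label is revealed. -/
def updateProg : Prog := .seq (.setNat 4 (.lit 0)) (.loop (.reg 1) updateBody)

/-- Both new values depend on the old ratio, so the potential in array 3 is updated before the ratio
in array 2; array 5 is scratch space for the increment `z i`. -/
theorem updateProg_spec (orc : ℕ → ℝ) (s : State) (z : ℕ → ℝ)
    (hz : ∀ i, z i = orc i * (s.arr 0 0 1 - (s.nat 3 : ℝ) / (s.nat 2 : ℝ)) /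
      (2 * s.arr 0 0 0 * (s.nat 2 : ℝ))) :
    ((∀ r, r < 3 → (updateProg.exec orc s).nat r = s.nat r) ∧
      (∀ i j, (updateProg.exec orc s).arr 0 i j = s.arr 0 i j) ∧
      (∀ i < s.nat 1, (updateProg.exec orc s).arr 3 i 0 =
        s.arr 3 i 0 + (1 + s.arr 3 i 0) * (z i * s.arr 2 i (s.nat 3))) ∧
      (∀ i < s.nat 1, ∀ j, (updateProg.exec orc s).arr 2 i j =
        if j = s.nat 3 then
          (s.arr 2 i j + z i) / (1 + z i * s.arr 2 i j) else s.arr 2 i j)) ∧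
    updateProg.time orc s ≤ 4 + s.nat 1 * 80 := by
  have h := Prog.loop_spec (orc := orc) (e := .reg 1) (s := s.setNat 4 0) (n := s.nat 1)
    (c := 79) (p := updateBody)
    (fun k s' => s'.nat 4 = k ∧ (∀ r, r ≠ 4 → s'.nat r = s.nat r) ∧
      (∀ i j, s'.arr 0 i j = s.arr 0 i j) ∧
      (∀ i, s'.arr 3 i 0 = if i < k then
        s.arr 3 i 0 + (1 + s.arr 3 i 0) * (z i * s.arr 2 i (s.nat 3)) else s.arr 3 i 0) ∧
      (∀ i j, s'.arr 2 i j = if i < k ∧ j = s.nat 3 then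
          (s.arr 2 i j + z i) / (1 + z i * s.arr 2 i j) else s.arr 2 i j)) rfl
    ⟨rfl, fun r hr => by simp [State.setNat_nat, hr], fun _ _ => rfl, by simp [State.setNat_arr],
      by simp [State.setNat_arr]⟩ ?_
  · obtain ⟨⟨-, h1, h2, h3, h4⟩, h5⟩ := h
    refine ⟨⟨fun r hr => h1 r (by omega), h2, fun i hi => ?_, fun i hi j => ?_⟩, ?_⟩
    · have := h3 i
      rwa [if_pos hi] at this
    · have := h4 i j
      simp only [hi, true_and] at this
      exact this
    · simp only [NExpr.size] at h5
      simp only [updateProg, Prog.time, NExpr.size, Prog.exec, NExpr.eval]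
      exact (Nat.add_le_add_left h5 _).trans (le_of_eq (by ring))
  · rintro k - s' ⟨h1, h2, h3, h4, h5⟩
    have e3 : s'.nat 3 = s.nat 3 := h2 3 (by norm_num)
    have e2 : s'.nat 2 = s.nat 2 := h2 2 (by norm_num)
    refine ⟨?_, ?_⟩
    · simp only [updateBody, Prog.exec, RExpr.eval, NExpr.eval,
        State.setNat_nat, State.setNat_arr, State.setArr_nat, State.setArr_arr, h1, e3, e2, h3,
        Rat.cast_one, Rat.cast_ofNat, ← hz]
      refine ⟨by simp, fun r hr => by simp [hr, h2 r hr], fun i j => by simp, fun i => ?_,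
        fun i j => ?_⟩
      · by_cases hi : i = k
        · subst hi
          simp [h4, h5]
        · have : i < k + 1 ↔ i < k := by omega
          simp [h4, hi, this]
      · by_cases hi : i = k
        · subst hi
          by_cases hj : j = s.nat 3
          · subst hj; simp [h5]
          · simp [hj, h5]
        · have : i < k + 1 ↔ i < k := by omega
          simp [h5, hi, this]
    · simp only [updateBody, Prog.time, RExpr.size, NExpr.size]
      norm_num

/-- The forecasting algorithm. -/
def forecaster : Algorithm where
  init := cubeRootProg
  predict := predictProg
  update := updateProg

end Multicalibration

/-! ### The potential and its relation to the calibration error. -/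

namespace Multicalibration

open RealRAM

section Potential

variable {X : Type*} {m : ℕ}

/-- The residual of a round, weighted by `h` and scaled by the learning rate `1 / (2 * B * m)`. -/
noncomputable def increment (B : ℝ) (h : X → ℝ) (r : Round X m) : ℝ :=
  h r.x * ((r.y : ℝ) - ((r.p : ℕ) : ℝ) / (m : ℝ)) / (2 * B * (m : ℝ))

/-- `(W⁺ - W⁻) / (W⁺ + W⁻)`, where `W⁺` and `W⁻` are the products of `1 + increment` and of
`1 - increment` over the rounds with forecast `j`. -/
noncomputable def ratio (B : ℝ) (h : X → ℝ) : History X m → ℕ → ℝ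
  | [], _ => 0
  | r :: π, j => if j = r.p then
      (ratio B h π j + increment B h r) / (1 + increment B h r * ratio B h π j)
      else ratio B h π j

/-- The product over all forecasts of `(W⁺ + W⁻) / 2`. -/
noncomputable def potential (B : ℝ) (h : X → ℝ) : History X m → ℝ
  | [] => 1
  | r :: π => potential B h π * (1 + increment B h r * ratio B h π r.p)

theorem abs_label_sub_le_one (r : Round X m) : |(r.y : ℝ) - ((r.p : ℕ) : ℝ) / (m : ℝ)| ≤ 1 := by
  have h1 := r.y.2.1
  have h2 := r.y.2.2
  have h3 : ((r.p : ℕ) : ℝ) / (m : ℝ) ≤ 1 :=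
    div_le_one_of_le₀ (by exact_mod_cast Nat.lt_succ_iff.1 r.p.2) (Nat.cast_nonneg _)
  have h4 : 0 ≤ ((r.p : ℕ) : ℝ) / (m : ℝ) := by positivity
  rw [abs_le]
  constructor <;> linarith

theorem abs_increment_le {B : ℝ} (hB : 0 < B) (hm : 0 < m) {h : X → ℝ} (hh : ∀ x, |h x| ≤ B)
    (r : Round X m) : |increment B h r| ≤ 1 / (2 * m) := by
  have hm' : (0 : ℝ) < m := by exact_mod_cast hm
  unfold increment
  rw [abs_div, abs_mul, abs_of_pos (by positivity : 0 < 2 * B * (m : ℝ)),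
    div_le_div_iff₀ (by positivity) (by positivity)]
  have : |h r.x| * |(r.y : ℝ) - ((r.p : ℕ) : ℝ) / (m : ℝ)| ≤ B * 1 :=
    mul_le_mul (hh _) (abs_label_sub_le_one r) (abs_nonneg _) hB.le
  nlinarith

theorem abs_increment_le_half {B : ℝ} (hB : 0 < B) (hm : 0 < m) {h : X → ℝ}
    (hh : ∀ x, |h x| ≤ B) (r : Round X m) : |increment B h r| ≤ 1 / 2 := by
  refine (abs_increment_le hB hm hh r).trans ?_
  have hm' : (1 : ℝ) ≤ m := by exact_mod_cast hm
  gcongr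
  linarith

theorem one_add_mul_pos {z R : ℝ} (hz : |z| ≤ 1 / 2) (hR : |R| < 1) : 0 < 1 + z * R := by
  have : |z * R| < 1 := by
    rw [abs_mul]
    nlinarith [abs_nonneg z, abs_nonneg R]
  linarith [(abs_lt.1 this).1]

theorem abs_ratio_lt_one {B : ℝ} (hB : 0 < B) (hm : 0 < m) {h : X → ℝ} (hh : ∀ x, |h x| ≤ B)
    (π : History X m) (j : ℕ) : |ratio B h π j| < 1 := by
  induction π with
  | nil => simp [ratio]
  | cons r π ih =>
    rw [ratio]
    split_ifs with hj
    · have hz := abs_increment_le_half hB hm hh r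
      have hp := one_add_mul_pos hz ih
      rw [abs_le] at hz
      rw [abs_lt] at ih ⊢
      rw [lt_div_iff₀ hp, div_lt_iff₀ hp]
      -- The update `(R + z) / (1 + z * R)` is the addition formula of `tanh`: the claims amount to
      -- `(1 ± R) * (1 ± z) > 0`, with equal signs.
      constructor <;> nlinarith
    · exact ih

theorem potential_pos {B : ℝ} (hB : 0 < B) (hm : 0 < m) {h : X → ℝ} (hh : ∀ x, |h x| ≤ B)
    (π : History X m) : 0 < potential B h π := by
  induction π with
  | nil => simp [potential]
  | cons r π ih =>
    exact mul_pos ih (one_add_mul_pos (abs_increment_le_half hB hm hh r)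
      (abs_ratio_lt_one hB hm hh π _))

/-- Each factor `1 + σ j * R j` equals `2 * W^σ / (W⁺ + W⁻)`, so it exchanges the average of `W⁺`
and `W⁻` for the one selected by `σ j`. As each factor is at most 2, a single expert weighs at most
`2 ^ (m + 1)` times the potential. -/
theorem potential_mul_prod {B : ℝ} (hB : 0 < B) (hm : 0 < m) {h : X → ℝ}
    (hh : ∀ x, |h x| ≤ B) {σ : Fin (m + 1) → ℝ} (hσ : ∀ j, σ j * σ j = 1) (π : History X m) :
    potential B h π * ∏ j : Fin (m + 1), (1 + σ j * ratio B h π j) =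
      (π.map fun r => 1 + σ r.p * increment B h r).prod := by
  induction π with
  | nil => simp [potential, ratio]
  | cons r π ih =>
    have hp := one_add_mul_pos (abs_increment_le_half hB hm hh r)
      (abs_ratio_lt_one hB hm hh π r.p)
    rw [List.map_cons, List.prod_cons, ← ih, potential,
      ← Finset.mul_prod_erase _ _ (Finset.mem_univ r.p),
      ← Finset.mul_prod_erase (Finset.univ : Finset (Fin (m + 1)))
        (fun j => 1 + σ j * ratio B h π j) (Finset.mem_univ r.p)]
    have he : ∏ j ∈ Finset.univ.erase r.p, (1 + σ j * ratio B h (r :: π) j) =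
        ∏ j ∈ Finset.univ.erase r.p, (1 + σ j * ratio B h π j) := by
      refine Finset.prod_congr rfl fun j hj => ?_
      have : (j : ℕ) ≠ r.p := fun hjp => (Finset.mem_erase.1 hj).1 (Fin.ext hjp)
      simp [ratio, this]
    have hr : (1 + increment B h r * ratio B h π r.p) * (1 + σ r.p * ratio B h (r :: π) r.p) =
        (1 + σ r.p * increment B h r) * (1 + σ r.p * ratio B h π r.p) := by
      rw [ratio, if_pos rfl]
      have := hσ r.p
      field_simp
      -- Both sides equal `1 + z * R + σ * (z + R)` once `σ * σ = 1` is used.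
      linear_combination (-(increment B h r * ratio B h π r.p)) * this
    rw [he]
    linear_combination (potential B h π *
      ∏ j ∈ Finset.univ.erase r.p, (1 + σ j * ratio B h π j)) * hr

/-- Passing to the reciprocal leaves a polynomial inequality: `(1 + z) * (1 - z + 2 * z ^ 2) = 1 + z
^ 2 * (1 + 2 * z)`, which is at least 1 for `z ≥ -1/2`. -/
theorem exp_sub_le_one_add {z : ℝ} (hz : |z| ≤ 1 / 2) : Real.exp (z - 2 * z ^ 2) ≤ 1 + z := by
  rw [abs_le] at hz
  have h1 : 2 * z ^ 2 - z + 1 ≤ Real.exp (2 * z ^ 2 - z) := Real.add_one_le_exp _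
  have h2 : Real.exp (z - 2 * z ^ 2) * Real.exp (2 * z ^ 2 - z) = 1 := by
    rw [← Real.exp_add]; simp
  have h3 : 1 ≤ (1 + z) * (2 * z ^ 2 - z + 1) := by nlinarith [sq_nonneg z]
  have h4 : 1 ≤ (1 + z) * Real.exp (2 * z ^ 2 - z) :=
    h3.trans (mul_le_mul_of_nonneg_left h1 (by linarith))
  exact le_of_mul_le_mul_right (h2.le.trans h4) (Real.exp_pos _)

theorem exp_sum_le_prod {ι : Type*} (l : List ι) (z : ι → ℝ) {δ : ℝ} (hδ : δ ≤ 1 / 2)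
    (hz : ∀ i ∈ l, |z i| ≤ δ) :
    Real.exp ((l.map z).sum - l.length * (2 * δ ^ 2)) ≤ (l.map fun i => 1 + z i).prod := by
  induction l with
  | nil => simp
  | cons a l ih =>
    have ha := hz a (by simp)
    have h1 := exp_sub_le_one_add (ha.trans hδ)
    have h2 := ih fun i hi => hz i (by simp [hi])
    have h3 : z a ^ 2 ≤ δ ^ 2 := sq_le_sq' (abs_le.1 ha).1 (abs_le.1 ha).2
    simp only [List.map_cons, List.sum_cons, List.prod_cons, List.length_cons]
    calc _ ≤ Real.exp ((z a - 2 * z a ^ 2) + ((l.map z).sum - l.length * (2 * δ ^ 2))) := by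
          refine Real.exp_le_exp.2 ?_
          push_cast
          linarith
      _ = Real.exp (z a - 2 * z a ^ 2) * Real.exp ((l.map z).sum - l.length * (2 * δ ^ 2)) :=
          Real.exp_add _ _
      _ ≤ _ := mul_le_mul h1 h2 (Real.exp_pos _).le ((Real.exp_pos _).le.trans h1)

theorem sum_mul_sum_filter (π : History X m) (σ : Fin (m + 1) → ℝ) (c : Round X m → ℝ) :
    ∑ j, σ j * ((π.filter fun r => r.p = j).map c).sum = (π.map fun r => σ r.p * c r).sum := by
  induction π with
  | nil => simp
  | cons r π ih =>
    rw [List.map_cons, List.sum_cons, ← ih]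
    have : ∀ j, σ j * (((r :: π).filter fun r => r.p = j).map c).sum =
        (if r.p = j then σ j * c r else 0) +
          σ j * ((π.filter fun r => r.p = j).map c).sum := by
      intro j
      by_cases hj : r.p = j
      · simp [hj, mul_add]
      · simp [hj]
    rw [Finset.sum_congr rfl fun j _ => this j, Finset.sum_add_distrib, Finset.sum_ite_eq]
    simp

/-- Taking the sign of each inner sum makes the error linear in the residuals, which ties it to a
single expert. -/
theorem exists_sign_calError (π : History X m) (h : X → ℝ) :
    ∃ σ : Fin (m + 1) → ℝ, (∀ j, σ j * σ j = 1) ∧ calError π h = (1 / (π.length : ℝ)) *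
      (π.map fun r => σ r.p * (h r.x * ((r.y : ℝ) - ((r.p : ℕ) : ℝ) / (m : ℝ)))).sum := by
  have : ∀ a : ℝ, ∃ s : ℝ, s * s = 1 ∧ |a| = s * a := fun a => by
    rcases abs_choice a with ha | ha
    · exact ⟨1, by norm_num, by linarith⟩
    · exact ⟨-1, by norm_num, by linarith⟩
  choose σ hσ1 hσ2 using fun j : Fin (m + 1) => this ((π.filter fun r => r.p = j).map
    fun r => h r.x * ((r.y : ℝ) - ((r.p : ℕ) : ℝ) / (m : ℝ))).sum
  refine ⟨σ, hσ1, ?_⟩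
  rw [← sum_mul_sum_filter π σ fun r => h r.x * ((r.y : ℝ) - ((r.p : ℕ) : ℝ) / (m : ℝ)),
    calError, ← Finset.mul_sum]
  congr 1
  exact Finset.sum_congr rfl fun j _ => hσ2 j

theorem abs_signed_le {σ a c : ℝ} (hσ : σ * σ = 1) (ha : |a| ≤ c) : σ * a ≤ c := by
  rcases mul_self_eq_one_iff.1 hσ with rfl | rfl <;> linarith [(abs_le.1 ha).1, (abs_le.1 ha).2]

theorem sum_map_le_sum_map_add {ι : Type*} (l : List ι) (f g : ι → ℝ) {c : ℝ}
    (hf : ∀ i ∈ l, f i ≤ g i + c) : (l.map f).sum ≤ (l.map g).sum + l.length * c := by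
  induction l with
  | nil => simp
  | cons a l ih =>
    have h1 := hf a (by simp)
    have h2 := ih fun i hi => hf i (by simp [hi])
    simp only [List.map_cons, List.sum_cons, List.length_cons]
    push_cast
    linarith

theorem calError_nonneg (π : History X m) (h : X → ℝ) : 0 ≤ calError π h :=
  Finset.sum_nonneg fun _ _ => mul_nonneg (by positivity) (abs_nonneg _)

/-- The signs optimal for `f` are admissible for `g`, and with fixed signs each round changes by at
most `c` because the residual `y - p` is at most 1 in absolute value. -/
theorem calError_le_of_abs_sub_le {π : History X m} {f g : X → ℝ} {c : ℝ}
    (hπ : 0 < π.length) (hfg : ∀ x, |f x - g x| ≤ c) : calError π f ≤ calError π g + c := by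
  obtain ⟨σ, hσ, hf⟩ := exists_sign_calError π f
  have hl : (0 : ℝ) < π.length := by exact_mod_cast hπ
  have hc : ∀ r ∈ π, 0 ≤ c := fun r _ => (abs_nonneg _).trans (hfg r.x)
  have hg : (1 / (π.length : ℝ)) * (π.map fun r => σ r.p *
      (g r.x * ((r.y : ℝ) - ((r.p : ℕ) : ℝ) / (m : ℝ)))).sum ≤ calError π g := by
    rw [← sum_mul_sum_filter π _ fun r => g r.x * ((r.y : ℝ) - ((r.p : ℕ) : ℝ) / (m : ℝ)),
      calError, ← Finset.mul_sum]
    gcongr with j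
    exact abs_signed_le (hσ j) le_rfl
  have hd : (π.map fun r => σ r.p *
      (f r.x * ((r.y : ℝ) - ((r.p : ℕ) : ℝ) / (m : ℝ)))).sum ≤ (π.map fun r => σ r.p *
      (g r.x * ((r.y : ℝ) - ((r.p : ℕ) : ℝ) / (m : ℝ)))).sum + π.length * c := by
    refine sum_map_le_sum_map_add _ _ _ fun r hr => ?_
    rw [← sub_le_iff_le_add', ← mul_sub, ← sub_mul]
    refine abs_signed_le (hσ _) ?_
    rw [abs_mul]
    calc _ ≤ c * 1 := mul_le_mul (hfg _) (abs_label_sub_le_one r) (abs_nonneg _) (hc r hr)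
      _ = c := mul_one c
  rw [hf]
  refine le_trans ?_ (add_le_add_left hg c)
  calc _ ≤ (1 / (π.length : ℝ)) * ((π.map fun r => σ r.p *
      (g r.x * ((r.y : ℝ) - ((r.p : ℕ) : ℝ) / (m : ℝ)))).sum + π.length * c) := by gcongr
    _ = _ := by field_simp

theorem calError_le {π : History X m} {h : X → ℝ} {B : ℝ} (hπ : 0 < π.length)
    (hh : ∀ x, |h x| ≤ B) : calError π h ≤ B := by
  have := calError_le_of_abs_sub_le (g := 0) hπ (by simpa using hh)
  simpa [calError] using this

theorem calError_le_log_potential {B : ℝ} (hB : 0 < B) (hm : 0 < m) {h : X → ℝ}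
    (hh : ∀ x, |h x| ≤ B) {π : History X m} (hπ : 0 < π.length) :
    calError π h ≤ (2 * B * m / π.length) *
      (Real.log (potential B h π) + (m + 1) * Real.log 2 + π.length / (2 * m ^ 2)) := by
  obtain ⟨σ, hσ, hf⟩ := exists_sign_calError π h
  have hm' : (0 : ℝ) < m := by exact_mod_cast hm
  have hm1 : (1 : ℝ) ≤ m := by exact_mod_cast hm
  have hl : (0 : ℝ) < π.length := by exact_mod_cast hπ
  have hV := potential_pos hB hm hh π
  -- With `δ = 1 / (2 * m)` the second-order loss over all rounds is `π.length / (2 * m ^ 2)`.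
  have h1 := exp_sum_le_prod π (fun r => σ r.p * increment B h r) (δ := 1 / (2 * m))
    (by gcongr; linarith) fun r _ => by
      have : |σ r.p| = 1 := by
        rcases mul_self_eq_one_iff.1 (hσ r.p) with h | h <;> simp [h]
      rw [abs_mul, this, one_mul]
      exact abs_increment_le hB hm hh r
  rw [← potential_mul_prod hB hm hh hσ π] at h1
  have h2 : ∏ j : Fin (m + 1), (1 + σ j * ratio B h π j) ≤ 2 ^ (m + 1) := by
    calc _ ≤ ∏ _j : Fin (m + 1), (2 : ℝ) := by
          refine Finset.prod_le_prod (fun j _ => ?_) fun j _ => ?_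
          · have := abs_signed_le (hσ j) (a := -ratio B h π j) (c := 1)
              (by rw [abs_neg]; exact (abs_ratio_lt_one hB hm hh π j).le)
            linarith
          · have := abs_signed_le (hσ j) (abs_ratio_lt_one hB hm hh π j).le
            linarith
      _ = 2 ^ (m + 1) := by simp
  have h3 := h1.trans (mul_le_mul_of_nonneg_left h2 hV.le)
  rw [← Real.le_log_iff_exp_le (by positivity), Real.log_mul hV.ne' (by positivity),
    Real.log_pow] at h3
  have h4 : (π.map fun r => σ r.p * increment B h r).sum =
      (π.length / (2 * B * m)) * calError π h := by
    have : (π.map fun r => σ r.p * increment B h r) = π.map fun r =>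
        (1 / (2 * B * m)) * (σ r.p * (h r.x * ((r.y : ℝ) - ((r.p : ℕ) : ℝ) / (m : ℝ)))) := by
      refine List.map_congr_left fun r _ => ?_
      rw [increment]
      ring
    rw [hf, this, List.sum_map_mul_left]
    field_simp
  rw [h4] at h3
  have h5 : (π.length : ℝ) * (2 * (1 / (2 * m)) ^ 2) = π.length / (2 * m ^ 2) := by
    field_simp
  rw [h5] at h3
  have h6 : (π.length / (2 * B * m)) * calError π h ≤
      Real.log (potential B h π) + (m + 1) * Real.log 2 + π.length / (2 * m ^ 2) := by
    push_cast at h3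
    linarith
  calc calError π h = (2 * B * m / π.length) * ((π.length / (2 * B * m)) * calError π h) := by
        field_simp
    _ ≤ _ := by gcongr

theorem sum_potential_step {N : ℕ} {B : ℝ} (hB : 0 < B) (hm : 0 < m) {g : Fin N → X → ℝ}
    (hg : ∀ i x, |g i x| ≤ B) (π : History X m) (x : X) (y : unitInterval) {w : ℕ → ℝ}
    (hw : IsBalanced m
      (fun j => ∑ i, potential B (g i) π * g i x * ratio B (g i) π j) w) :
    ∑ j : Fin (m + 1), w j * ∑ i, potential B (g i) (⟨x, y, j⟩ :: π) ≤
      (1 + 1 / (2 * (m : ℝ) ^ 2)) * ∑ i, potential B (g i) π := by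
  have hm' : (0 : ℝ) < m := by exact_mod_cast hm
  set S := ∑ i, potential B (g i) π with hS
  set F : ℕ → ℝ := fun j => ∑ i, potential B (g i) π * g i x * ratio B (g i) π j with hF
  have hstep : ∀ j : Fin (m + 1), ∑ i, potential B (g i) (⟨x, y, j⟩ :: π) =
      S + (1 / (2 * B * m)) * (((y : ℝ) - (j : ℕ) / m) * F j) := by
    intro j
    rw [hF, hS]
    simp only [potential, increment, Finset.mul_sum]
    rw [← Finset.sum_add_distrib]
    refine Finset.sum_congr rfl fun i _ => ?_
    ring
  -- Ratios are below 1 in absolute value, so each function contributes at most `B` times its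
  -- potential.
  have hM : ∀ j ≤ m, |F j| ≤ B * S := by
    intro j _
    rw [hS, Finset.mul_sum]
    refine (Finset.abs_sum_le_sum_abs _ _).trans (Finset.sum_le_sum fun i _ => ?_)
    have h0 := potential_pos hB hm (hg i) π
    rw [abs_mul, abs_mul, abs_of_pos h0]
    calc _ ≤ potential B (g i) π * B * 1 := by
          gcongr
          · exact hg i x
          · exact (abs_ratio_lt_one hB hm (hg i) π j).le
      _ = _ := by ring
  have h1 := hw.sum_le y y.2.1 y.2.2 _ hM
  have h2 := hw.sum_eq
  rw [← Fin.sum_univ_eq_sum_range (fun j => w j * (((y : ℝ) - (j : ℕ) / m) * F j))] at h1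
  rw [← Fin.sum_univ_eq_sum_range] at h2
  calc _ = (∑ j : Fin (m + 1), w j) * S + (1 / (2 * B * m)) *
        ∑ j : Fin (m + 1), w j * (((y : ℝ) - (j : ℕ) / m) * F j) := by
        simp only [hstep, mul_add, Finset.sum_add_distrib, ← Finset.sum_mul]
        congr 1
        rw [Finset.mul_sum]
        exact Finset.sum_congr rfl fun j _ => by ring
    _ ≤ 1 * S + (1 / (2 * B * m)) * (B * S / m) := by
        rw [h2]
        gcongr
    _ = _ := by field_simp

end Potential

/-! ### Recursive expectations over the forecasts. -/

section Expectation

variable {X : Type*} {m : ℕ} {w : History X m → X → Fin (m + 1) → ℝ} {A : Adversary X m}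

theorem expectedValue_mono (hw : ∀ π x i, 0 ≤ w π x i) {F G : History X m → ℝ} {n : ℕ}
    {π : History X m} (hFG : ∀ π' : History X m, π'.length = π.length + n → F π' ≤ G π') :
    expectedValue w A F n π ≤ expectedValue w A G n π := by
  induction n generalizing π with
  | zero => exact hFG π rfl
  | succ n ih =>
    refine Finset.sum_le_sum fun i _ => mul_le_mul_of_nonneg_left ?_ (hw _ _ _)
    refine ih fun π' h => hFG π' ?_
    rw [h, List.length_cons]
    omega

theorem expectedValue_mul_add (hw : ∀ π x, ∑ i, w π x i = 1) (F : History X m → ℝ) (a b : ℝ)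
    (n : ℕ) (π : History X m) :
    expectedValue w A (fun π => a * F π + b) n π = a * expectedValue w A F n π + b := by
  induction n generalizing π with
  | zero => rfl
  | succ n ih =>
    simp only [expectedValue, ih, mul_add, Finset.sum_add_distrib, ← Finset.sum_mul, hw, one_mul,
      Finset.mul_sum]
    congr 1
    exact Finset.sum_congr rfl fun i _ => by ring

theorem expectedValue_const (hw : ∀ π x, ∑ i, w π x i = 1) (b : ℝ) (n : ℕ) (π : History X m) :
    expectedValue w A (fun _ => b) n π = b := by
  simpa using expectedValue_mul_add (A := A) hw (fun _ => 0) 0 b n π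

/-- A supermartingale bound: the one-step inequality holds for every context and label, hence for
those of any adaptive adversary. -/
theorem expectedValue_le_pow_mul (hw : ∀ π x i, 0 ≤ w π x i) {F : History X m → ℝ} {ρ : ℝ}
    (hρ : 0 ≤ ρ) (hF : ∀ π x y, ∑ i, w π x i * F (⟨x, y, i⟩ :: π) ≤ ρ * F π) (n : ℕ)
    (π : History X m) : expectedValue w A F n π ≤ ρ ^ n * F π := by
  induction n generalizing π with
  | zero => simp [expectedValue]
  | succ n ih =>
    calc expectedValue w A F (n + 1) π
        ≤ ∑ i, w π (A π).1 i * (ρ ^ n * F (⟨(A π).1, (A π).2, i⟩ :: π)) :=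
          Finset.sum_le_sum fun i _ => mul_le_mul_of_nonneg_left (ih _) (hw _ _ _)
      _ = ρ ^ n * ∑ i, w π (A π).1 i * F (⟨(A π).1, (A π).2, i⟩ :: π) := by
          rw [Finset.mul_sum]
          exact Finset.sum_congr rfl fun i _ => by ring
      _ ≤ ρ ^ n * (ρ * F π) := mul_le_mul_of_nonneg_left (hF _ _ _) (by positivity)
      _ = ρ ^ (n + 1) * F π := by ring

end Expectation

end Multicalibration

/-! ### Correctness, running time and error of the algorithm. -/

namespace Multicalibration

open RealRAM

theorem discretization_spec (T N : ℕ) (B : ℝ) :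
    forecaster.discretization T N B ^ 3 ≤ T ∧ T < (forecaster.discretization T N B + 1) ^ 3 :=
  (cubeRootProg_spec (fun _ => 0) (Algorithm.input T N B) rfl).1.1

theorem discretization_pos {T : ℕ} (hT : 1 ≤ T) (N : ℕ) (B : ℝ) :
    0 < forecaster.discretization T N B := by
  rcases Nat.eq_zero_or_pos (forecaster.discretization T N B) with h | h
  · have := (discretization_spec T N B).2
    rw [h] at this
    omega
  · exact h

theorem discretization_le (T N : ℕ) (B : ℝ) : forecaster.discretization T N B ≤ T :=
  (Nat.le_self_pow (by norm_num) _).trans (discretization_spec T N B).1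

section Run

variable {X : Type*} {N m : ℕ} {B : ℝ} {T : ℕ} {g : Fin N → X → ℝ}

/-- The memory holds the parameters, the potentials (shifted by one) and the ratios of a
history. -/
structure Represents (g : Fin N → X → ℝ) (T : ℕ) (B : ℝ) (π : History X m) (s : State) :
    Prop where
  nat_one : s.nat 1 = N
  nat_two : s.nat 2 = m
  bound : s.arr 0 0 0 = B
  potential_eq : ∀ i : Fin N, s.arr 3 i 0 = potential B (g i) π - 1
  ratio_eq : ∀ (i : Fin N) (j : ℕ), s.arr 2 i j = ratio B (g i) π j

theorem Represents.beforeUpdate {π : History X m} {s : State} (hm : 0 < m)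
    (hs : Represents g T B π s) (r : Round X m) :
    Represents g T B π (forecaster.beforeUpdate g s r) := by
  obtain ⟨⟨h1, h2, -⟩, -⟩ := predictProg_spec (Algorithm.oracle g r.x) s
    (by rw [hs.nat_two]; exact hm)
  refine ⟨?_, ?_, ?_, fun i => ?_, fun i j => ?_⟩
  · exact (h1 1 (by norm_num)).trans hs.nat_one
  · exact (h1 2 (by norm_num)).trans hs.nat_two
  · simpa [Algorithm.beforeUpdate, forecaster, State.setArr_arr, State.setNat_arr] using
      (h2 0 0 0 (by norm_num) (by norm_num)).trans hs.bound
  · simpa [Algorithm.beforeUpdate, forecaster, State.setArr_arr, State.setNat_arr] using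
      (h2 3 i 0 (by norm_num) (by norm_num)).trans (hs.potential_eq i)
  · simpa [Algorithm.beforeUpdate, forecaster, State.setArr_arr, State.setNat_arr] using
      (h2 2 i j (by norm_num) (by norm_num)).trans (hs.ratio_eq i j)

theorem Represents.update {π : History X m} {s : State} {r : Round X m}
    (hs : Represents g T B π s) (h3 : s.nat 3 = r.p) (hy : s.arr 0 0 1 = r.y) :
    Represents g T B (r :: π) (updateProg.exec (Algorithm.oracle g r.x) s) := by
  obtain ⟨⟨h1, h2, h4, h5⟩, -⟩ := updateProg_spec (Algorithm.oracle g r.x) s _ fun i => rfl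
  have hz : ∀ i : Fin N, Algorithm.oracle g r.x i * (s.arr 0 0 1 - (s.nat 3 : ℝ) / (s.nat 2 : ℝ)) /
      (2 * s.arr 0 0 0 * (s.nat 2 : ℝ)) = increment B (g i) r := by
    intro i
    simp [increment, Algorithm.oracle, hy, h3, hs.nat_two, hs.bound]
  refine ⟨(h1 1 (by norm_num)).trans hs.nat_one, (h1 2 (by norm_num)).trans hs.nat_two,
    (h2 0 0).trans hs.bound, fun i => ?_, fun i j => ?_⟩
  · rw [h4 i (by rw [hs.nat_one]; exact i.2), hz, hs.potential_eq, hs.ratio_eq, h3, potential]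
    ring
  · rw [h5 i (by rw [hs.nat_one]; exact i.2), hz, hs.ratio_eq, h3, ratio]

theorem represents_stateAfter (hm : forecaster.discretization T N B = m) (hm0 : 0 < m)
    (π : History X m) : Represents g T B π (forecaster.stateAfter g T B π) := by
  induction π with
  | nil =>
    obtain ⟨⟨-, h1, h2⟩, -⟩ := cubeRootProg_spec (fun _ => 0) (Algorithm.input T N B) rfl
    have ha : (forecaster.stateAfter (m := m) g T B []).arr = (Algorithm.input T N B).arr := h2
    -- Storing the potential minus one lets the zeroed memory represent the empty history, so no
    -- initialization of the `N` functions is needed.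
    refine ⟨h1 1 (by norm_num), hm, ?_, fun i => ?_, fun i j => ?_⟩ <;> rw [ha] <;>
      simp [Algorithm.input, potential, ratio]
  | cons r π ih =>
    refine (ih.beforeUpdate hm0 r).update ?_ ?_
    · simp [Algorithm.beforeUpdate, State.setArr_nat, State.setNat_nat]
    · simp [Algorithm.beforeUpdate, State.setArr_arr]

/-- No sign of `B` is needed: balance concerns the computed scores alone, so the weights form a
distribution even when `B = 0`. -/
theorem isBalanced_weights (hm : forecaster.discretization T N B = m) (hm0 : 0 < m)
    (π : History X m) (x : X) :
    IsBalanced m (fun j => ∑ i, potential B (g i) π * g i x * ratio B (g i) π j)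
      ((predictProg.exec (Algorithm.oracle g x) (forecaster.stateAfter g T B π)).arr 1 0) := by
  have hs : Represents g T B π _ := represents_stateAfter hm hm0 π
  obtain ⟨⟨-, -, h⟩, -⟩ := predictProg_spec (Algorithm.oracle g x) _
    (by rw [hs.nat_two]; exact hm0)
  rw [hs.nat_one, hs.nat_two] at h
  convert h using 1
  funext j
  rw [score, ← Fin.sum_univ_eq_sum_range (fun i => (1 + State.arr _ 3 i 0) *
    Algorithm.oracle g x i * State.arr _ 2 i j)]
  refine Finset.sum_congr rfl fun i _ => ?_
  rw [hs.potential_eq, hs.ratio_eq]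
  simp [Algorithm.oracle]

theorem weights_nonneg (hm : forecaster.discretization T N B = m) (hm0 : 0 < m)
    (π : History X m) (x : X) (i : Fin (m + 1)) : 0 ≤ forecaster.weights g T B π x i :=
  (isBalanced_weights hm hm0 π x).nonneg i (Nat.lt_succ_iff.1 i.2)

theorem sum_weights (hm : forecaster.discretization T N B = m) (hm0 : 0 < m)
    (π : History X m) (x : X) : ∑ i, forecaster.weights g T B π x i = 1 := by
  rw [← (isBalanced_weights (g := g) hm hm0 π x).sum_eq, ← Fin.sum_univ_eq_sum_range]
  rfl

theorem runTime_le (hm : forecaster.discretization T N B = m) (hm0 : 0 < m) (hN : 1 ≤ N)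
    (π : History X m) :
    forecaster.runTime g T B π ≤ N * (2 + 25 * T + π.length * (209 + 53 * T)) := by
  have hmT : m ≤ T := hm ▸ discretization_le T N B
  induction π with
  | nil =>
    have h := (cubeRootProg_spec (fun _ => 0) (Algorithm.input T N B) rfl).2
    have hT : (Algorithm.input T N B).nat 0 = T := rfl
    rw [hT] at h
    have e : forecaster.runTime (m := m) g T B [] =
      cubeRootProg.time (fun _ => 0) (Algorithm.input T N B) := rfl
    rw [e, List.length_nil]
    nlinarith
  | cons r π ih =>
    have hs : Represents g T B π _ := represents_stateAfter hm hm0 π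
    have h1 := (predictProg_spec (Algorithm.oracle g r.x) _ (by rw [hs.nat_two]; exact hm0)).2
    have h2 := (updateProg_spec (Algorithm.oracle g r.x)
      (forecaster.beforeUpdate g (forecaster.stateAfter g T B π) r) _ fun i => rfl).2
    rw [(hs.beforeUpdate hm0 r).nat_one] at h2
    rw [hs.nat_one, hs.nat_two] at h1
    have e : forecaster.runTime g T B (r :: π) = forecaster.runTime g T B π
      + predictProg.time (Algorithm.oracle g r.x) (forecaster.stateAfter g T B π)
      + (m + 1) + updateProg.time (Algorithm.oracle g r.x)
        (forecaster.beforeUpdate g (forecaster.stateAfter g T B π) r) := rfl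
    rw [e, List.length_cons]
    -- The facts `m ≤ T` and `1 ≤ N` absorb every term into a multiple of `N`; here `209 = 156 + 52
    -- + 1` and `53 = 52 + 1`, with `156 * N` bounding the remaining `76 + 80 * N`.
    have h3 : (m + 1) * (28 + N * 24) ≤ (T + 1) * (52 * N) :=
      Nat.mul_le_mul (by omega) (by omega)
    have h4 : T + 1 ≤ (T + 1) * N := Nat.le_mul_of_pos_right _ hN
    have h5 : N * (2 + 25 * T + (π.length + 1) * (209 + 53 * T)) =
        N * (2 + 25 * T + π.length * (209 + 53 * T)) +
          (156 * N + (T + 1) * (52 * N) + (T + 1) * N) := by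
      ring
    rw [h5]
    omega

variable {H : Set (X → ℝ)}

theorem multicalError_nonneg (π : History X m) (H : Set (X → ℝ)) : 0 ≤ multicalError π H :=
  Real.iSup_nonneg fun _ => calError_nonneg _ _

theorem multicalError_le (hH : H.Nonempty) (hB : ∀ h ∈ H, ∀ x, |h x| ≤ B) {π : History X m}
    (hπ : 0 < π.length) : multicalError π H ≤ B := by
  have := hH.to_subtype
  exact ciSup_le fun h => calError_le hπ (hB h h.2)

theorem expectedError_nonneg (hm : forecaster.discretization T N B = m) (hm0 : 0 < m)
    (A : Adversary X m) : 0 ≤ forecaster.expectedError g T B H A := by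
  rw [← expectedValue_const (A := A) (sum_weights (g := g) hm hm0) 0 T []]
  exact expectedValue_mono (weights_nonneg hm hm0) fun π _ => multicalError_nonneg π H

theorem expectedError_le_bound (hm : forecaster.discretization T N B = m) (hm0 : 0 < m)
    (hT : 1 ≤ T) (hH : H.Nonempty) (hB : ∀ h ∈ H, ∀ x, |h x| ≤ B) (A : Adversary X m) :
    forecaster.expectedError g T B H A ≤ B := by
  refine le_trans ?_ (expectedValue_const (A := A) (sum_weights (g := g) hm hm0) B T []).le
  refine expectedValue_mono (weights_nonneg hm hm0) fun π hπ => multicalError_le hH hB ?_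
  rw [hπ, List.length_nil]
  omega

/-- The error of a class with a finite cover, in terms of the total potential of the cover.  The
logarithm is replaced by its tangent at `M`. -/
theorem multicalError_le_sum_potential (hB0 : 0 < B) (hm0 : 0 < m) (hH : H.Nonempty) {β : ℝ}
    (hg : ∀ i x, |g i x| ≤ B) (hcov : ∀ h ∈ H, ∃ i, ∀ x, |h x - g i x| ≤ β)
    {π : History X m} (hπ : 0 < π.length) {M : ℝ} (hM : 0 < M) :
    multicalError π H ≤ (2 * B * m / π.length) * (M⁻¹ * ∑ i, potential B (g i) π - 1 + Real.log M +
      (m + 1) * Real.log 2 + π.length / (2 * m ^ 2)) + β := by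
  have := hH.to_subtype
  refine ciSup_le fun h => ?_
  obtain ⟨i, hi⟩ := hcov h h.2
  refine (calError_le_of_abs_sub_le hπ hi).trans ?_
  gcongr
  refine (calError_le_log_potential hB0 hm0 (hg i) hπ).trans ?_
  have hpos := potential_pos hB0 hm0 (hg i) π
  have hsum : potential B (g i) π ≤ ∑ i, potential B (g i) π :=
    Finset.single_le_sum (f := fun i => potential B (g i) π)
      (fun i _ => (potential_pos hB0 hm0 (hg i) π).le) (Finset.mem_univ i)
  -- The tangent bound is affine in the potential, so expectations can be taken directly, in place
  -- of Jensen's inequality for the concave logarithm.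
  have hlog := Real.log_le_sub_one_of_pos (mul_pos (inv_pos.2 hM) hpos)
  rw [Real.log_mul (inv_pos.2 hM).ne' hpos.ne', Real.log_inv] at hlog
  have hmul := mul_le_mul_of_nonneg_left hsum (inv_pos.2 hM).le
  gcongr
  linarith

theorem expectedError_le_log (hm : forecaster.discretization T N B = m) (hm0 : 0 < m)
    (hT : 1 ≤ T) (hN : 1 ≤ N) (hB0 : 0 < B) (hH : H.Nonempty) {β : ℝ}
    (hg : ∀ i x, |g i x| ≤ B) (hcov : ∀ h ∈ H, ∃ i, ∀ x, |h x - g i x| ≤ β)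
    (A : Adversary X m) :
    forecaster.expectedError g T B H A ≤ (2 * B * m / T) *
      (Real.log N + (m + 1) * Real.log 2 + T / m ^ 2) + β := by
  have hm' : (0 : ℝ) < m := by exact_mod_cast hm0
  have hN' : (0 : ℝ) < N := by exact_mod_cast hN
  have hT' : (0 : ℝ) < T := by exact_mod_cast hT
  -- `M` bounds the expected final total potential; with the tangent taken there, `M⁻¹ * M` cancels
  -- the `-1`. Growth and second-order loss contribute `T / (2 * m ^ 2)` each.
  set M : ℝ := N * Real.exp (T / (2 * m ^ 2)) with hMdef
  have hM : 0 < M := by positivity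
  have hlogM : Real.log M = Real.log N + T / (2 * m ^ 2) := by
    rw [hMdef, Real.log_mul hN'.ne' (Real.exp_pos _).ne', Real.log_exp]
  set Φ : History X m → ℝ := fun π => ∑ i, potential B (g i) π with hΦ
  have hΦT : expectedValue (forecaster.weights g T B) A Φ T [] ≤ M := by
    have h := expectedValue_le_pow_mul (A := A) (F := Φ) (weights_nonneg (g := g) hm hm0)
      (ρ := 1 + 1 / (2 * (m : ℝ) ^ 2)) (by positivity)
      (fun π x y => sum_potential_step hB0 hm0 hg π x y (isBalanced_weights hm hm0 π x)) T []
    have h0 : Φ [] = N := by simp [hΦ, potential]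
    rw [h0] at h
    refine h.trans ?_
    rw [hMdef, mul_comm]
    gcongr
    calc (1 + 1 / (2 * (m : ℝ) ^ 2)) ^ T ≤ Real.exp (1 / (2 * (m : ℝ) ^ 2)) ^ T := by
          gcongr
          rw [add_comm]
          exact Real.add_one_le_exp _
      _ = _ := by
          rw [← Real.exp_nat_mul]
          congr 1
          ring
  set a : ℝ := (2 * B * m / T) * M⁻¹ with ha
  set b : ℝ := (2 * B * m / T) * (-1 + Real.log M + (m + 1) * Real.log 2 + T / (2 * m ^ 2)) + β
    with hb
  have ha0 : 0 ≤ a := by positivity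
  calc forecaster.expectedError g T B H A
      ≤ expectedValue (forecaster.weights g T B) A (fun π => a * Φ π + b) T [] := by
        refine expectedValue_mono (weights_nonneg hm hm0) fun π hπ => ?_
        rw [List.length_nil, zero_add] at hπ
        refine (multicalError_le_sum_potential hB0 hm0 hH hg hcov (by omega) hM).trans (le_of_eq ?_)
        rw [hπ, ha, hb]
        ring
    _ = a * expectedValue (forecaster.weights g T B) A Φ T [] + b :=
        expectedValue_mul_add (sum_weights hm hm0) _ _ _ _ _
    _ ≤ a * M + b := by gcongr
    _ = _ := by
        rw [ha, hb, hlogM]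
        field_simp
        ring

end Run

/-! ### The rate in `T` and the theorem. -/

theorem one_le_log_six_mul {T N : ℕ} (hT : 1 ≤ T) (hN : 1 ≤ N) :
    1 ≤ Real.log (6 * (T : ℝ) * (N : ℝ)) := by
  have hT' : (1 : ℝ) ≤ T := by exact_mod_cast hT
  have hN' : (1 : ℝ) ≤ N := by exact_mod_cast hN
  have h : (6 : ℝ) ≤ 6 * T * N := by nlinarith [mul_le_mul hT' hN' zero_le_one (by linarith)]
  rw [Real.le_log_iff_exp_le (by linarith)]
  linarith [Real.exp_one_lt_d9]

/-- With `a = T ^ (1/3)` and `s = √L`, where `L = log (6TN)`, one has `m ≤ a ≤ 2 * m` and `s ≥ 1`.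
The three terms cost `2`, `4` and `4` times `s / a`. Only the first uses `s ≤ a`, through `log N ≤ L
= s ^ 2 ≤ s * a`. -/
theorem rate_le {T N m : ℕ} (hT : 1 ≤ T) (hN : 1 ≤ N) (hm : 0 < m) (hmT : m ^ 3 ≤ T)
    (hTm : T < (m + 1) ^ 3)
    (hL : Real.sqrt (Real.log (6 * (T : ℝ) * (N : ℝ))) ≤ (T : ℝ) ^ (1 / 3 : ℝ)) :
    (2 * (m : ℝ) / T) * (Real.log N + (m + 1) * Real.log 2 + T / m ^ 2) ≤
      10 * ((T : ℝ) ^ (-(1 / 3) : ℝ) * Real.sqrt (Real.log (6 * (T : ℝ) * (N : ℝ)))) := by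
  have hT' : (1 : ℝ) ≤ T := by exact_mod_cast hT
  have hN' : (1 : ℝ) ≤ N := by exact_mod_cast hN
  have hm' : (1 : ℝ) ≤ m := by exact_mod_cast hm
  have hL1 := one_le_log_six_mul hT hN
  have hlogN : Real.log N ≤ Real.log (6 * (T : ℝ) * (N : ℝ)) :=
    Real.log_le_log (by linarith) (by nlinarith)
  rw [Real.rpow_neg (by linarith)]
  set a : ℝ := (T : ℝ) ^ (1 / 3 : ℝ) with ha
  have ha0 : 0 < a := by positivity
  have ha3 : a ^ 3 = T := by
    rw [ha, ← Real.rpow_natCast, ← Real.rpow_mul (by linarith)]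
    norm_num
  set L := Real.log (6 * (T : ℝ) * (N : ℝ)) with hLdef
  set s := Real.sqrt L with hs
  have hs1 : 1 ≤ s := Real.one_le_sqrt.2 hL1
  have hs2 : s ^ 2 = L := Real.sq_sqrt (by linarith)
  have hma : (m : ℝ) ≤ a := by
    refine le_of_pow_le_pow_left₀ (n := 3) (by norm_num) ha0.le ?_
    rw [ha3]
    exact_mod_cast hmT
  have ham : a ≤ 2 * m := by
    have : a < m + 1 := by
      refine lt_of_pow_lt_pow_left₀ 3 (by linarith) ?_
      rw [ha3]
      exact_mod_cast hTm
    linarith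
  rw [← ha3]
  have h1 : 2 * (m : ℝ) / a ^ 3 * Real.log N ≤ 2 * (a⁻¹ * s) := by
    calc 2 * (m : ℝ) / a ^ 3 * Real.log N ≤ 2 * a / a ^ 3 * (s * a) := by
          have : 0 ≤ Real.log N := Real.log_nonneg hN'
          gcongr
          nlinarith
      _ = 2 * (a⁻¹ * s) := by field_simp
  have h2 : 2 * (m : ℝ) / a ^ 3 * ((m + 1) * Real.log 2) ≤ 4 * (a⁻¹ * s) := by
    have hlog2 : Real.log 2 ≤ 1 := by linarith [Real.log_two_lt_d9]
    calc 2 * (m : ℝ) / a ^ 3 * ((m + 1) * Real.log 2) ≤ 2 * a / a ^ 3 * ((a + a) * 1) := by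
          have : (m + 1) * Real.log 2 ≤ (a + a) * 1 :=
            mul_le_mul (by linarith) hlog2 (Real.log_nonneg (by norm_num)) (by linarith)
          gcongr
      _ = 4 * (a⁻¹ * 1) := by field_simp; ring
      _ ≤ 4 * (a⁻¹ * s) := by gcongr
  have h3 : 2 * (m : ℝ) / a ^ 3 * (a ^ 3 / m ^ 2) ≤ 4 * (a⁻¹ * s) := by
    calc 2 * (m : ℝ) / a ^ 3 * (a ^ 3 / m ^ 2) = 2 / m := by field_simp
      _ ≤ 4 * a⁻¹ := by
          rw [← div_eq_mul_inv, div_le_div_iff₀ (by linarith) ha0]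
          linarith
      _ ≤ 4 * (a⁻¹ * s) := by
          gcongr
          exact le_mul_of_one_le_right (by positivity) hs1
  rw [mul_add, mul_add]
  linarith

theorem expectedError_le {X : Type*} {H : Set (X → ℝ)} {T N m : ℕ} {B β : ℝ}
    {g : Fin N → X → ℝ} (hm : forecaster.discretization T N B = m) (hT : 1 ≤ T) (hN : 1 ≤ N)
    (hH : H.Nonempty) (hB : ∀ h ∈ H, ∀ x, |h x| ≤ B) (hβ : 0 ≤ β) (hgH : ∀ i, g i ∈ H)
    (hcov : ∀ h ∈ H, ∃ i, ∀ x, |h x - g i x| ≤ β) (A : Adversary X m) :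
    forecaster.expectedError g T B H A ≤
      10 * (B * (T : ℝ) ^ (-(1 / 3) : ℝ) *
        Real.sqrt (Real.log (6 * (T : ℝ) * (N : ℝ)))) + β := by
  have hm0 : 0 < m := hm ▸ discretization_pos hT N B
  obtain ⟨hmT, hTm⟩ := discretization_spec T N B
  rw [hm] at hmT hTm
  have hT' : (0 : ℝ) < T := by exact_mod_cast hT
  have htriv := expectedError_le_bound (g := g) hm hm0 hT hH hB A
  obtain ⟨h, hh⟩ := hH
  -- The adversary supplies a context, so `X` is nonempty and `B` cannot be negative.
  have hB0 : 0 ≤ B := (abs_nonneg _).trans (hB h hh (A []).1)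
  rcases hB0.eq_or_lt with rfl | hB0
  · simpa using htriv.trans hβ
  rcases le_total (Real.sqrt (Real.log (6 * (T : ℝ) * (N : ℝ)))) ((T : ℝ) ^ (1 / 3 : ℝ))
    with hL | hL
  · refine (expectedError_le_log hm hm0 hT hN hB0 ⟨h, hh⟩ (fun i => hB _ (hgH i)) hcov A).trans ?_
    refine add_le_add ?_ le_rfl
    have := mul_le_mul_of_nonneg_left (rate_le hT hN hm0 hmT hTm hL) hB0.le
    calc _ = B * ((2 * (m : ℝ) / T) * (Real.log N + (m + 1) * Real.log 2 + T / m ^ 2)) := by ring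
      _ ≤ _ := this
      _ = _ := by ring
  -- Here the claimed rate already exceeds the trivial bound `B`.
  · have h1 : 1 ≤ (T : ℝ) ^ (-(1 / 3) : ℝ) * Real.sqrt (Real.log (6 * (T : ℝ) * (N : ℝ))) := by
      rw [Real.rpow_neg hT'.le, ← div_eq_inv_mul, one_le_div (by positivity)]
      exact hL
    have h2 := mul_le_mul_of_nonneg_left h1 hB0.le
    rw [mul_one, ← mul_assoc] at h2
    linarith

end Multicalibration

/-- One algorithm, one constant `C` and one polynomial `q` serve all instances.  The algorithm has
query access to an arbitrary enumeration `e` of the minimal cover `Hβ`.  A randomized adversary is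
a random choice `ω` of a deterministic adaptive one. -/
theorem theorem2 :
    ∃ (alg : Multicalibration.Algorithm) (C : ℝ) (q : Polynomial ℕ),
      ∀ (X : Type*) (H : Set (X → ℝ)) (B β : ℝ) (Hβ : Finset (X → ℝ))
        (e : Fin Hβ.card ≃ Hβ) (T : ℕ),
        H.Nonempty → (∀ h ∈ H, ∀ x, |h x| ≤ B) → 0 ≤ β →
        Multicalibration.IsMinimalCover H β Hβ → 1 ≤ T →
        -- the forecasts are drawn from a distribution on `{0, 1/m, …, 1}` with `m ≥ 1`
        0 < alg.discretization T Hβ.card B ∧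
        (∀ (π : Multicalibration.History X (alg.discretization T Hβ.card B)) (x : X),
          π.length < T →
          alg.weights (fun i => (e i : X → ℝ)) T B π x ∈
            stdSimplex ℝ (Fin (alg.discretization T Hβ.card B + 1))) ∧
        -- the running time is linear in the size of the cover and polynomial in `T`
        (∀ π : Multicalibration.History X (alg.discretization T Hβ.card B),
          π.length = T →
          alg.runTime (fun i => (e i : X → ℝ)) T B π ≤ Hβ.card * q.eval T) ∧
        -- the expected error against every (possibly randomized, adaptive) adversary
        (∀ (Ω : Type*) [MeasurableSpace Ω] (μ : MeasureTheory.Measure Ω)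
          [MeasureTheory.IsProbabilityMeasure μ]
          (A : Ω → Multicalibration.Adversary X (alg.discretization T Hβ.card B)),
          MeasureTheory.AEStronglyMeasurable
            (fun ω => alg.expectedError (fun i => (e i : X → ℝ)) T B H (A ω)) μ →
          MeasureTheory.Integrable
            (fun ω => alg.expectedError (fun i => (e i : X → ℝ)) T B H (A ω)) μ ∧
          ∫ ω, alg.expectedError (fun i => (e i : X → ℝ)) T B H (A ω) ∂μ ≤
            C * (B * (T : ℝ) ^ (-(1 / 3) : ℝ) *
              Real.sqrt (Real.log (6 * (T : ℝ) * (Hβ.card : ℝ)))) + β) := by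
  refine ⟨Multicalibration.forecaster, 10,
    2 + 25 * Polynomial.X + Polynomial.X * (209 + 53 * Polynomial.X), ?_⟩
  intro X H B β Hβ e T hH hB hβ hcov hT
  obtain ⟨⟨hsub, hcover⟩, -⟩ := hcov
  have hN : 1 ≤ Hβ.card := by
    obtain ⟨h, hh⟩ := hH
    obtain ⟨f, hf, -⟩ := hcover h hh
    exact Finset.card_pos.2 ⟨f, hf⟩
  have hm0 := Multicalibration.discretization_pos hT Hβ.card B
  refine ⟨hm0, fun π x _ => ⟨Multicalibration.weights_nonneg rfl hm0 π x,
    Multicalibration.sum_weights rfl hm0 π x⟩, fun π hπ => ?_, ?_⟩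
  · have h := Multicalibration.runTime_le (g := fun i => (e i : X → ℝ)) rfl hm0 hN π
    rw [hπ] at h
    simpa using h
  · intro Ω _ μ _ A hA
    have hint : MeasureTheory.Integrable (fun ω => Multicalibration.forecaster.expectedError
        (fun i => (e i : X → ℝ)) T B H (A ω)) μ := by
      -- For each deterministic adversary the expected error lies in `[0, B]`, so measurability
      -- alone gives integrability, and averaging over `ω` preserves the uniform bound.
      refine MeasureTheory.Integrable.of_bound hA B (Filter.Eventually.of_forall fun ω => ?_)
      rw [Real.norm_of_nonneg (Multicalibration.expectedError_nonneg rfl hm0 (A ω))]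
      exact Multicalibration.expectedError_le_bound rfl hm0 hT hH hB (A ω)
    refine ⟨hint, ?_⟩
    refine (MeasureTheory.integral_mono hint (MeasureTheory.integrable_const _) fun ω =>
      Multicalibration.expectedError_le rfl hT hN hH hB hβ (fun i => hsub (e i).2)
        (fun h hh => ?_) (A ω)).trans (by simp)
    obtain ⟨f, hf, hfh⟩ := hcover h hh
    exact ⟨e.symm ⟨f, hf⟩, by simpa using hfh⟩
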